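/- **Lemma 3.12.** Let $d\ge 1$. Write $J^s=(I-\Delta)^{s/2}$ ($s\in\mathbb R$) and $D^\beta=(-\Delta)^{\beta/2}$ ($\beta\ge 0$) for the Fourier multipliers with symbols $(1+|\xi|^2)^{s/2}$ and $|\xi|^\beta$ (with the Fourier transform $\widehat f(\xi)=\int f(x)e^{-ix\cdot\xi}\,dx$), acting on tempered distributions, respectively on elements of Sobolev spaces. For $s\in\mathbb R$ let $H^{s}(\mathbb R^d)$ be the space of complex-valued tempered distributions $f$ with $J^{s}f\in L^2(\mathbb R^d)$, with norm $\|J^s f\|_{L^2}$. Let $m\ge 0$ be an integer, and let $\theta_1,\theta_2\in C^\infty(\mathbb R^d)\setminus\{0\}$ satisfy $0\le\theta_1,\theta_2\le 1$, $\partial^\gamma\theta_1,\partial^\gamma\theta_2\in L^\infty(\mathbb R^d)$ for all multi-indices $\gamma$, and $$\operatorname{dist}\big(\operatorname{supp}(1-\theta_1),\operatorname{supp}(\theta_2)\big)\ge\delta>0$$ (where the distance to the empty set is $+\infty$). Below, all products $\theta_j T$ are products of a smooth function with a tempered distribution, and each constant $C$ depends only on $d$, $m$, $\delta$, $\theta_1$,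 $\theta_2$ and the exponents $\beta$, respectively $r,s$, respectively $s$, but not on $f$. (I) If $0\le\beta<2$, there is $C$ such that for every $f\in H^{-m}(\mathbb R^d)$ with $\theta_1 f,\ \theta_1D^\beta f\in L^2(\mathbb R^d)$ one has $\theta_2J^\beta f\in L^2(\mathbb R^d)$ and $$\|\theta_2J^\beta f\|_{L^2}\le C\big(\|\theta_1 f\|_{L^2}+\|\theta_1D^\beta f\|_{L^2}+\|J^{-m}f\|_{L^2}\big).$$ (II) If $0\le\beta<2$, there is $C$ such that for every $f\in H^{-m}(\mathbb R^d)$ with $\theta_1J^\beta f\in L^2(\mathbb R^d)$ one has $\theta_2 f,\ \theta_2D^\beta f\in L^2(\mathbb R^d)$ and $$\|\theta_2 f\|_{L^2}+\|\theta_2D^\beta f\|_{L^2}\le C\big(\|\theta_1J^\beta f\|_{L^2}+\|J^{-m}f\|_{L^2}\big).$$ (III) If $s>0$ and $0\le r\le s$, there is $C$ such that for every $f\in H^{-m}(\mathbb R^d)$ with $\theta_1J^sf\in L^2(\mathbb R^d)$ one has $\theta_2J^rf\in L^2(\mathbb R^d)$ and $$\|\theta_2J^rf\|_{L^2}\le C\big(\|\theta_1J^sf\|_{L^2}+\|J^{-m}f\|_{L^2}\big).$$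 (IV) If $s>0$, there is $C$ such that for every $f\in H^{-m}(\mathbb R^d)$ with $\theta_1J^sf\in L^2(\mathbb R^d)$ one has $J^s(\theta_2f)\in L^2(\mathbb R^d)$ and $$\|J^s(\theta_2f)\|_{L^2}\le C\big(\|\theta_1J^sf\|_{L^2}+\|J^{-m}f\|_{L^2}\big).$$ -/

import Mathlib

open MeasureTheory FourierTransform Real
open scoped SchwartzMap ENNReal NNReal ContDiff

noncomputable section

namespace FracLoc

/-- The Euclidean space `ℝ^d`. -/
abbrev Rd (d : ℕ) : Type := EuclideanSpace ℝ (Fin d)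

/-- Complex-valued tempered distributions on `ℝ^d`. -/
abbrev TD (d : ℕ) : Type := TemperedDistribution (Rd d) ℂ

variable {d : ℕ}

/-- The symbol `(1 + |2πξ|²)^{s/2}` of `J^s`. Mathlib's Fourier transform has the kernel
`exp(-2πi x·ξ)`, for which `-Δ` has the symbol `|2πξ|²`. -/
def besselSymbol (d : ℕ) (s : ℝ) (ξ : Rd d) : ℝ :=
  (1 + (2 * π * ‖ξ‖) ^ 2) ^ (s / 2)

/-- The Bessel operator `J^s = (I - Δ)^{s/2}` on tempered distributions. -/
def besselJ (s : ℝ) (f : TD d) : TD d :=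
  TemperedDistribution.fourierMultiplierCLM ℂ (fun ξ : Rd d => (besselSymbol d s ξ : ℂ)) f

/-- The tempered distribution `T` is (given by) an `L²` function. -/
def MemL2 (T : TD d) : Prop :=
  ∃ u : Lp ℂ 2 (volume : Measure (Rd d)), T = (u : TD d)

/-- The `L²` norm of a tempered distribution: the norm of the `L²` function that gives it,
and `∞` if there is none. -/
def l2Norm (T : TD d) : ℝ≥0∞ :=
  ⨅ (u : Lp ℂ 2 (volume : Measure (Rd d))) (_ : T = (u : TD d)), ‖u‖ₑ

/-- Membership in the Sobolev space `H^s(ℝ^d)`, whose norm is `‖J^s f‖_{L²}`. -/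
def MemH (s : ℝ) (f : TD d) : Prop := MemL2 (besselJ s f)

/-- The product `θ T` of a tempered distribution with a smooth real function of moderate growth. -/
def mulDist (θ : Rd d → ℝ) (T : TD d) : TD d :=
  TemperedDistribution.smulLeftCLM ℂ (fun x : Rd d => (θ x : ℂ)) T

/-- The tempered distribution `T` is integration against the function `h`. -/
def RepresentedBy (T : TD d) (h : Rd d → ℂ) : Prop :=
  ∀ φ : 𝓢(Rd d, ℂ), Integrable (fun ξ => φ ξ * h ξ) ∧ T φ = ∫ ξ, φ ξ * h ξ

/-- `g = D^β f`: the Fourier transform of `f` is a function, and the Fourier transform of `g`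
is the function `|2πξ|^β` times it. -/
def IsFracDeriv (β : ℝ) (f g : TD d) : Prop :=
  ∃ h : Rd d → ℂ, RepresentedBy (𝓕 f) h ∧
    RepresentedBy (𝓕 g) (fun ξ => (((2 * π * ‖ξ‖) ^ β : ℝ) : ℂ) * h ξ)

open scoped Classical in
/-- The operator `D^β = (-Δ)^{β/2}`, on all tempered distributions for which it is defined by
multiplication on the Fourier side (and `0` on the others). For `β ≥ 0` every element of every
Sobolev space is of the first kind, see `isFracDeriv_fracD`. -/
def fracD (β : ℝ) (f : TD d) : TD d :=
  if h : ∃ g, IsFracDeriv β f g then h.choose else 0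

/-- `θ` is a smooth function with values in `[0, 1]`, not identically zero, all of whose
derivatives (of every order) are bounded. -/
structure IsCutoff (θ : Rd d → ℝ) : Prop where
  smooth : ContDiff ℝ ∞ θ
  ne_zero : θ ≠ 0
  nonneg : ∀ x, 0 ≤ θ x
  le_one : ∀ x, θ x ≤ 1
  bounded_deriv : ∀ n : ℕ, ∃ C : ℝ, ∀ x, ‖iteratedFDeriv ℝ n θ x‖ ≤ C

/-! ### The operators and the norm are well defined -/

theorem besselSymbol_hasTemperateGrowth (s : ℝ) :
    (fun ξ : Rd d => (besselSymbol d s ξ : ℂ)).HasTemperateGrowth := by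
  have h1 : (fun ξ : Rd d => (2 * π) • ξ).HasTemperateGrowth := by fun_prop
  have h2 := (Function.hasTemperateGrowth_one_add_norm_sq_rpow (Rd d) (s / 2)).comp h1
  have h3 : (fun ξ : Rd d => besselSymbol d s ξ).HasTemperateGrowth := by
    have e : (fun ξ : Rd d => besselSymbol d s ξ) =
        (fun x : Rd d => (1 + ‖x‖ ^ 2) ^ (s / 2)) ∘ fun ξ => (2 * π) • ξ := by
      funext ξ
      simp [besselSymbol, norm_smul, abs_of_pos Real.pi_pos]
    rw [e]
    exact h2
  fun_prop

theorem besselSymbol_pos (s : ℝ) (ξ : Rd d) : 0 < besselSymbol d s ξ := by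
  unfold besselSymbol; positivity

theorem IsCutoff.hasTemperateGrowth {θ : Rd d → ℝ} (h : IsCutoff θ) :
    (fun x : Rd d => (θ x : ℂ)).HasTemperateGrowth := by
  have : θ.HasTemperateGrowth := by
    refine ⟨h.smooth, fun n => ?_⟩
    obtain ⟨C, hC⟩ := h.bounded_deriv n
    exact ⟨0, C, fun x => by simpa using hC x⟩
  fun_prop

theorem toTemperedDistribution_injective {u v : Lp ℂ 2 (volume : Measure (Rd d))}
    (h : (u : TD d) = (v : TD d)) : u = v := by
  have := LinearMap.ker_eq_bot.1 (Lp.ker_toTemperedDistributionCLM_eq_bot (F := ℂ)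
    (μ := (volume : Measure (Rd d))) (p := 2))
  exact this h

theorem l2Norm_coe (u : Lp ℂ 2 (volume : Measure (Rd d))) : l2Norm (u : TD d) = ‖u‖ₑ := by
  refine le_antisymm (iInf_le_of_le u (iInf_le_of_le rfl le_rfl)) (le_iInf₂ fun v hv => ?_)
  rw [toTemperedDistribution_injective hv]

theorem representedBy_smul_Lp {g : Rd d → ℂ} (hg : g.HasTemperateGrowth)
    (u : Lp ℂ 2 (volume : Measure (Rd d))) :
    RepresentedBy (TemperedDistribution.smulLeftCLM ℂ g (u : TD d)) (fun ξ => g ξ * u ξ) := by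
  intro φ
  have e : (fun ξ => φ ξ * (g ξ * u ξ)) =
      fun ξ => SchwartzMap.smulLeftCLM ℂ g φ ξ * u ξ := by
    ext ξ
    rw [SchwartzMap.smulLeftCLM_apply_apply hg]
    simp only [smul_eq_mul]; ring
  rw [e]
  refine ⟨?_, ?_⟩
  · exact MemLp.integrable_mul ((SchwartzMap.smulLeftCLM ℂ g φ).memLp 2) (Lp.memLp u)
  · simp

theorem RepresentedBy.congr {T : TD d} {h k : Rd d → ℂ} (hT : RepresentedBy T h)
    (hk : h =ᵐ[volume] k) : RepresentedBy T k := by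
  intro φ
  have e : (fun ξ => φ ξ * h ξ) =ᵐ[volume] fun ξ => φ ξ * k ξ := by
    filter_upwards [hk] with ξ hξ
    rw [hξ]
  exact ⟨(hT φ).1.congr e, (hT φ).2.trans (integral_congr_ae e)⟩

theorem RepresentedBy.locallyIntegrable {T : TD d} {h : Rd d → ℂ} (hT : RepresentedBy T h) :
    LocallyIntegrable h := by
  rw [locallyIntegrable_iff]
  intro K hK
  obtain ⟨χ, χs, χc, χK⟩ : ∃ χ : Rd d → ℝ, ContDiff ℝ ∞ χ ∧ HasCompactSupport χ ∧
      ∀ x ∈ K, χ x = 1 := by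
    obtain ⟨R, hR0, hR⟩ := hK.isBounded.subset_ball_lt 0 0
    let b : ContDiffBump (0 : Rd d) := ⟨R, R + 1, hR0, by linarith⟩
    refine ⟨b, b.contDiff, b.hasCompactSupport, fun x hx => ?_⟩
    exact b.one_of_mem_closedBall (Metric.ball_subset_closedBall (hR hx))
  have c1 : HasCompactSupport (Complex.ofRealCLM ∘ χ) := χc.comp_left rfl
  have c2 : ContDiff ℝ ∞ (Complex.ofRealCLM ∘ χ) := by fun_prop
  refine ((hT (c1.toSchwartzMap c2)).1.integrableOn (s := K)).congr_fun ?_ hK.measurableSet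
  intro x hx
  simp [χK x hx]

theorem RepresentedBy.ae_eq {T : TD d} {h k : Rd d → ℂ} (hT : RepresentedBy T h)
    (kT : RepresentedBy T k) : h =ᵐ[volume] k := by
  refine ae_eq_of_integral_contDiff_smul_eq hT.locallyIntegrable kT.locallyIntegrable ?_
  intro χ χs χc
  have c1 : HasCompactSupport (Complex.ofRealCLM ∘ χ) := χc.comp_left rfl
  have c2 : ContDiff ℝ ∞ (Complex.ofRealCLM ∘ χ) := by fun_prop
  have := (hT (c1.toSchwartzMap c2)).2.symm.trans (kT (c1.toSchwartzMap c2)).2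
  simpa using this

theorem RepresentedBy.unique {T S : TD d} {h : Rd d → ℂ} (hT : RepresentedBy T h)
    (hS : RepresentedBy S h) : T = S := by
  ext φ
  rw [(hT φ).2, (hS φ).2]

/-- `D^β f` is unique. -/
theorem IsFracDeriv.unique {β : ℝ} {f g g' : TD d} (hg : IsFracDeriv β f g)
    (hg' : IsFracDeriv β f g') : g = g' := by
  obtain ⟨h, h1, h2⟩ := hg
  obtain ⟨k, k1, k2⟩ := hg'
  have e : (fun ξ : Rd d => (((2 * π * ‖ξ‖) ^ β : ℝ) : ℂ) * h ξ) =ᵐ[volume]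
      fun ξ => (((2 * π * ‖ξ‖) ^ β : ℝ) : ℂ) * k ξ := by
    filter_upwards [h1.ae_eq k1] with ξ hξ
    rw [hξ]
  have := (h2.congr e).unique k2
  rw [← fourierInv_fourier_eq (F := TD d) g, this, fourierInv_fourier_eq]

theorem besselJ_neg_besselJ (s : ℝ) (f : TD d) : besselJ (-s) (besselJ s f) = f := by
  unfold besselJ
  rw [TemperedDistribution.fourierMultiplierCLM_fourierMultiplierCLM_apply
    (besselSymbol_hasTemperateGrowth s) (besselSymbol_hasTemperateGrowth (-s))]
  have e : ((fun ξ : Rd d => (besselSymbol d s ξ : ℂ)) * fun ξ => (besselSymbol d (-s) ξ : ℂ)) =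
      fun _ => (1 : ℂ) := by
    ext ξ
    simp only [Pi.mul_apply]
    norm_cast
    unfold besselSymbol
    rw [← Real.rpow_add (by positivity), neg_div, add_neg_cancel, Real.rpow_zero]
  rw [e]
  simp

/-- `D^β f` exists for `f` in a Sobolev space and `β ≥ 0`. -/
theorem exists_isFracDeriv {s β : ℝ} (hβ : 0 ≤ β) {f : TD d} (hf : MemH s f) :
    ∃ g, IsFracDeriv β f g := by
  obtain ⟨w, hw⟩ := hf
  let v : Lp ℂ 2 (volume : Measure (Rd d)) := 𝓕 w
  have hfv : 𝓕 f = TemperedDistribution.smulLeftCLM ℂ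
      (fun ξ : Rd d => (besselSymbol d (-s) ξ : ℂ)) (v : TD d) := by
    rw [← besselJ_neg_besselJ s f, hw, besselJ,
      TemperedDistribution.fourierMultiplierCLM_apply, fourier_fourierInv_eq,
      Lp.fourier_toTemperedDistribution_eq]
  -- the bounded symbol of `D^β J^{-β}`
  let σ : Rd d → ℂ := fun ξ => (((2 * π * ‖ξ‖) ^ β * besselSymbol d (-β) ξ : ℝ) : ℂ)
  have hσb : ∀ ξ, ‖σ ξ‖ ≤ 1 := by
    intro ξ
    have h0 : (0 : ℝ) ≤ 2 * π * ‖ξ‖ := by positivity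
    simp only [σ, Complex.norm_real, Real.norm_eq_abs]
    rw [abs_of_nonneg (mul_nonneg (Real.rpow_nonneg h0 _) (besselSymbol_pos _ _).le)]
    unfold besselSymbol
    rw [neg_div, Real.rpow_neg (by positivity), ← div_eq_mul_inv]
    refine div_le_one_of_le₀ ?_ (by positivity)
    calc (2 * π * ‖ξ‖) ^ β = ((2 * π * ‖ξ‖) ^ 2) ^ (β / 2) := by
          rw [← Real.rpow_natCast, ← Real.rpow_mul h0]
          congr 1
          push_cast; ring
      _ ≤ _ := Real.rpow_le_rpow (by positivity) (by linarith) (by positivity)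
  have hσm : Measurable σ := by
    unfold σ besselSymbol
    fun_prop
  have hm : MemLp (fun ξ => σ ξ * v ξ) 2 := by
    refine (Lp.memLp v).mono (hσm.aestronglyMeasurable.mul (Lp.aestronglyMeasurable v)) ?_
    filter_upwards with ξ
    rw [norm_mul]
    exact mul_le_of_le_one_left (norm_nonneg _) (hσb ξ)
  refine ⟨𝓕⁻ (TemperedDistribution.smulLeftCLM ℂ
    (fun ξ : Rd d => (besselSymbol d (β - s) ξ : ℂ)) ((hm.toLp _ : Lp ℂ 2 volume) : TD d)),
    fun ξ => (besselSymbol d (-s) ξ : ℂ) * v ξ, ?_, ?_⟩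
  · rw [hfv]
    exact representedBy_smul_Lp (besselSymbol_hasTemperateGrowth _) v
  · rw [fourier_fourierInv_eq]
    refine (representedBy_smul_Lp (besselSymbol_hasTemperateGrowth _) _).congr ?_
    filter_upwards [hm.coeFn_toLp] with ξ hξ
    rw [hξ]
    have e : besselSymbol d (β - s) ξ * besselSymbol d (-β) ξ = besselSymbol d (-s) ξ := by
      unfold besselSymbol
      rw [← Real.rpow_add (by positivity)]
      congr 1; ring
    simp only [σ]
    rw [← e]
    push_cast
    ring

/-- On every Sobolev space and for `β ≥ 0`, `fracD β f` is the distribution whose Fourier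
transform is `|2πξ|^β` times the function `𝓕 f`. -/
theorem isFracDeriv_fracD {s β : ℝ} (hβ : 0 ≤ β) {f : TD d} (hf : MemH s f) :
    IsFracDeriv β f (fracD β f) := by
  have h := exists_isFracDeriv hβ hf
  unfold fracD
  rw [dif_pos h]
  exact h.choose_spec

end FracLoc

end

/-! Write ⟨ξ⟩² = 1 + |2πξ|². A tempered distribution is an L² function of norm at most `C` exactly
when it is bounded by `C` times the L² norm on Schwartz functions (`exists_Lp_of_bound`,
`norm_Lp_apply_le`). All operators are therefore transposed onto test functions, and each claim
becomes a bound for `f` tested on a Fourier multiplier applied to `θ₂ φ`.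

The four claims rest on one estimate, `exists_localized_bound`: for a symbol `a` of order `t`, the
pairing of `g` with `a(D)(θ₂ φ)` is controlled by the L² bound on `θ₁ g` and by any global Sobolev
bound on `g`. Insert 1 = θ₁ + (1 - θ₁). The first part uses the bound on `θ₁ g`. For the second, 1 -
θ₁ lives at distance δ from θ₂, where `a` may be replaced by a symbol of order as low as desired
(`exists_symbol_eq_off_support`), so even a weak bound on `g` suffices.

That pseudolocality comes from a cutoff χ supported in the δ-ball with χ(0) = 1. Let k be its
Fourier transform, so ∫ k = 1. Removing from the convolution kernel of `a(D)` its part near the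
diagonal replaces `a` by a - k * a, an average of differences of `a`; by the mean value inequality
and Peetre's inequality it has order one less (`IsSymbol.convDiff`). Iterating gives every order.

The estimate also needs θ₁ and θ₂ to be multipliers of every Sobolev space
(`BddSmooth.sobolevBounded`): trivial at order 0, raised by one through the product rule,
interpolated with a quadratic K-functional for orders in (0, 1), and dualized for negative orders.

Finally, |ξ|^β is not smooth at the origin. Away from it, |ξ|^β and ⟨ξ⟩^β differ by factors that are
symbols of order 0; on bounded frequencies all weights are comparable, and the global Sobolev norm
of `f` controls that part. -/

noncomputable section

namespace FracLoc

variable {d : ℕ}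

/-! ### The `L²` norm on Schwartz functions -/

/-- The `L²` norm of a Schwartz function. -/
def sNorm (φ : 𝓢(Rd d, ℂ)) : ℝ := ‖φ.toLp 2 (volume : Measure (Rd d))‖

theorem sNorm_nonneg (φ : 𝓢(Rd d, ℂ)) : 0 ≤ sNorm φ := norm_nonneg _

theorem sNorm_eq_toReal (φ : 𝓢(Rd d, ℂ)) : sNorm φ = (eLpNorm φ 2 volume).toReal :=
  SchwartzMap.norm_toLp

theorem ofReal_sNorm (φ : 𝓢(Rd d, ℂ)) : ENNReal.ofReal (sNorm φ) = eLpNorm φ 2 volume := by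
  rw [sNorm_eq_toReal, ENNReal.ofReal_toReal (φ.memLp 2 volume).eLpNorm_ne_top]

theorem ofReal_sNorm_sq (φ : 𝓢(Rd d, ℂ)) :
    ENNReal.ofReal (sNorm φ ^ 2) = ∫⁻ x, ENNReal.ofReal (‖φ x‖ ^ 2) := by
  have h : sNorm φ ^ 2 = ∫ x, ‖φ x‖ ^ 2 := by
    rw [sNorm, SchwartzMap.norm_toLp' (by simp) (by simp)]
    simp only [ENNReal.toReal_ofNat, Real.rpow_ofNat]
    rw [← Real.rpow_natCast, ← Real.rpow_mul (by positivity)]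
    norm_num
  rw [h, ofReal_integral_eq_lintegral_ofReal]
  · exact (φ.memLp 2).integrable_norm_pow (by simp)
  · exact Filter.Eventually.of_forall fun x => by positivity

theorem sNorm_le_of_norm_le {φ ψ : 𝓢(Rd d, ℂ)} {C : ℝ} (h : ∀ x, ‖φ x‖ ≤ C * ‖ψ x‖) :
    sNorm φ ≤ C * sNorm ψ := by
  refine Lp.norm_le_mul_norm_of_ae_le_mul ?_
  filter_upwards [φ.coeFn_toLp 2 volume, ψ.coeFn_toLp 2 volume] with x h1 h2
  rw [h1, h2]
  exact h x

theorem sNorm_add_le (φ ψ : 𝓢(Rd d, ℂ)) : sNorm (φ + ψ) ≤ sNorm φ + sNorm ψ :=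
  norm_add_le (φ.toLp 2 (volume : Measure (Rd d))) (ψ.toLp 2 volume)

theorem sNorm_le_sum {ι : Type*} (s : Finset ι) {φ : 𝓢(Rd d, ℂ)} {ψ : ι → 𝓢(Rd d, ℂ)}
    (h : ∀ x, ‖φ x‖ ≤ ∑ i ∈ s, ‖ψ i x‖) : sNorm φ ≤ ∑ i ∈ s, sNorm (ψ i) := by
  have hfin : ∀ i ∈ s, eLpNorm (ψ i) 2 volume ≠ ⊤ := fun i _ =>
    ((ψ i).memLp 2 volume).eLpNorm_ne_top
  simp only [sNorm_eq_toReal]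
  rw [← ENNReal.toReal_sum hfin]
  refine ENNReal.toReal_mono (ENNReal.sum_ne_top.2 hfin) ?_
  calc eLpNorm φ 2 volume ≤ eLpNorm (∑ i ∈ s, fun x => ‖ψ i x‖) 2 volume := by
        refine eLpNorm_mono fun x => (h x).trans ?_
        simpa using le_abs_self _
    _ ≤ ∑ i ∈ s, eLpNorm (fun x => ‖ψ i x‖) 2 volume :=
        eLpNorm_sum_le (fun i _ => (ψ i).continuous.norm.aestronglyMeasurable) (by norm_num)
    _ = _ := by simp

theorem sNorm_fourier (φ : 𝓢(Rd d, ℂ)) : sNorm (𝓕 φ) = sNorm φ :=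
  SchwartzMap.norm_fourier_toL2_eq φ

theorem sNorm_fourierInv (φ : 𝓢(Rd d, ℂ)) : sNorm (𝓕⁻ φ) = sNorm φ := by
  rw [← sNorm_fourier (𝓕⁻ φ), fourier_fourierInv_eq]

/-- The `L²` inner product of Schwartz functions. -/
def sInner (φ ψ : 𝓢(Rd d, ℂ)) : ℂ := ∫ x, inner ℂ (φ x) (ψ x)

theorem sInner_eq_inner (φ ψ : 𝓢(Rd d, ℂ)) :
    sInner φ ψ = inner ℂ (φ.toLp 2 (volume : Measure (Rd d))) (ψ.toLp 2 volume) :=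
  (SchwartzMap.inner_toL2_toL2_eq φ ψ volume).symm

theorem norm_sInner_le (φ ψ : 𝓢(Rd d, ℂ)) : ‖sInner φ ψ‖ ≤ sNorm φ * sNorm ψ := by
  rw [sInner_eq_inner]
  exact norm_inner_le_norm _ _

theorem norm_sInner_self (φ : 𝓢(Rd d, ℂ)) : ‖sInner φ φ‖ = sNorm φ ^ 2 := by
  rw [sInner_eq_inner, inner_self_eq_norm_sq_to_K]
  simp [sNorm]

/-! ### Multiplication operators and Fourier multipliers on Schwartz functions -/

/-- Multiplication by a function of temperate growth. -/
abbrev smulS (g : Rd d → ℂ) : 𝓢(Rd d, ℂ) →L[ℂ] 𝓢(Rd d, ℂ) := SchwartzMap.smulLeftCLM ℂ g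

/-- The transpose `φ ↦ 𝓕 (g · 𝓕⁻ φ)` of the Fourier multiplier with symbol `g`. -/
def mulF (g : Rd d → ℂ) : 𝓢(Rd d, ℂ) →L[ℂ] 𝓢(Rd d, ℂ) :=
  fourierCLM ℂ 𝓢(Rd d, ℂ) ∘L smulS g ∘L fourierInvCLM ℂ 𝓢(Rd d, ℂ)

theorem mulF_apply (g : Rd d → ℂ) (φ : 𝓢(Rd d, ℂ)) : mulF g φ = 𝓕 (smulS g (𝓕⁻ φ)) := rfl

theorem smulS_apply {g : Rd d → ℂ} (hg : g.HasTemperateGrowth) (φ : 𝓢(Rd d, ℂ)) (x : Rd d) :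
    smulS g φ x = g x * φ x := SchwartzMap.smulLeftCLM_apply_apply hg φ x

theorem besselJ_apply (s : ℝ) (f : TD d) (φ : 𝓢(Rd d, ℂ)) :
    besselJ s f φ = f (mulF (fun ξ => (besselSymbol d s ξ : ℂ)) φ) := rfl

theorem mulDist_apply (θ : Rd d → ℝ) (f : TD d) (φ : 𝓢(Rd d, ℂ)) :
    mulDist θ f φ = f (smulS (fun x => (θ x : ℂ)) φ) := rfl

theorem fourierInv_mulF (g : Rd d → ℂ) (φ : 𝓢(Rd d, ℂ)) :
    𝓕⁻ (mulF g φ) = smulS g (𝓕⁻ φ) := by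
  rw [mulF_apply, fourierInv_fourier_eq]

theorem mulF_mulF {g h : Rd d → ℂ} (hg : g.HasTemperateGrowth) (hh : h.HasTemperateGrowth)
    (φ : 𝓢(Rd d, ℂ)) : mulF g (mulF h φ) = mulF (fun ξ => g ξ * h ξ) φ := by
  rw [mulF_apply, fourierInv_mulF, SchwartzMap.smulLeftCLM_smulLeftCLM_apply hg hh]
  rfl

theorem mulF_one (φ : 𝓢(Rd d, ℂ)) : mulF (fun _ => 1) φ = φ := by
  rw [mulF_apply, smulS, SchwartzMap.smulLeftCLM_const]
  simp

theorem sNorm_mulF (g : Rd d → ℂ) (φ : 𝓢(Rd d, ℂ)) :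
    sNorm (mulF g φ) = sNorm (smulS g (𝓕⁻ φ)) := by
  rw [mulF_apply, sNorm_fourier]

theorem sNorm_mulF_le {g h : Rd d → ℂ} (hg : g.HasTemperateGrowth) (hh : h.HasTemperateGrowth)
    {C : ℝ} (H : ∀ ξ, ‖g ξ‖ ≤ C * ‖h ξ‖) (φ : 𝓢(Rd d, ℂ)) :
    sNorm (mulF g φ) ≤ C * sNorm (mulF h φ) := by
  rw [sNorm_mulF, sNorm_mulF]
  refine sNorm_le_of_norm_le fun ξ => ?_
  rw [smulS_apply hg, smulS_apply hh, norm_mul, norm_mul, ← mul_assoc]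
  exact mul_le_mul_of_nonneg_right (H ξ) (norm_nonneg _)

theorem sNorm_smulS_le_of_bounded {g : Rd d → ℂ} (hg : g.HasTemperateGrowth) {C : ℝ}
    (H : ∀ ξ, ‖g ξ‖ ≤ C) (φ : 𝓢(Rd d, ℂ)) : sNorm (smulS g φ) ≤ C * sNorm φ := by
  refine sNorm_le_of_norm_le fun x => ?_
  rw [smulS_apply hg, norm_mul]
  exact mul_le_mul_of_nonneg_right (H x) (norm_nonneg _)

theorem sInner_smulS {g : Rd d → ℝ} (hg : (fun x => (g x : ℂ)).HasTemperateGrowth)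
    (φ ψ : 𝓢(Rd d, ℂ)) :
    sInner φ (smulS (fun x => (g x : ℂ)) ψ) = sInner (smulS (fun x => (g x : ℂ)) φ) ψ := by
  unfold sInner
  congr 1
  ext x
  rw [smulS_apply hg, smulS_apply hg]
  simp
  ring

theorem sInner_fourier (φ ψ : 𝓢(Rd d, ℂ)) : sInner (𝓕 φ) (𝓕 ψ) = sInner φ ψ :=
  SchwartzMap.integral_inner_fourier_fourier φ ψ

theorem sInner_mulF {g : Rd d → ℝ} (hg : (fun x => (g x : ℂ)).HasTemperateGrowth)
    (φ ψ : 𝓢(Rd d, ℂ)) :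
    sInner φ (mulF (fun x => (g x : ℂ)) ψ) = sInner (mulF (fun x => (g x : ℂ)) φ) ψ := by
  rw [mulF_apply, mulF_apply]
  nth_rw 1 [← fourier_fourierInv_eq (F := 𝓢(Rd d, ℂ)) φ]
  rw [sInner_fourier, sInner_smulS hg, ← sInner_fourier _ (𝓕⁻ ψ), fourier_fourierInv_eq]

/-! ### Tempered distributions bounded in `L²` -/

theorem norm_star_Lp_le (u : Lp ℂ 2 (volume : Measure (Rd d))) : ‖star u‖ ≤ ‖u‖ := by
  refine Lp.norm_le_norm_of_ae_le ?_
  filter_upwards [Lp.coeFn_star u] with x hx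
  rw [hx, Pi.star_apply, norm_star]

theorem norm_Lp_apply_le (u : Lp ℂ 2 (volume : Measure (Rd d))) (φ : 𝓢(Rd d, ℂ)) :
    ‖(u : TD d) φ‖ ≤ ‖u‖ * sNorm φ := by
  have e : (u : TD d) φ = inner ℂ (star (φ.toLp 2 (volume : Measure (Rd d)))) u := by
    rw [Lp.toTemperedDistribution_apply, L2.inner_def]
    refine integral_congr_ae ?_
    filter_upwards [φ.coeFn_toLp 2 volume, Lp.coeFn_star (φ.toLp 2 (volume : Measure (Rd d)))]
      with x h1 h2
    rw [h2, Pi.star_apply, h1]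
    simp [mul_comm]
  rw [e, mul_comm]
  exact (norm_inner_le_norm _ _).trans
    (mul_le_mul_of_nonneg_right (norm_star_Lp_le _) (norm_nonneg _))

/-- Schwartz functions are dense in L², so `T` extends to a bounded functional there, and the Riesz
theorem represents it. -/
theorem exists_Lp_of_bound {T : TD d} {C : ℝ} (hC : 0 ≤ C)
    (h : ∀ φ : 𝓢(Rd d, ℂ), ‖T φ‖ ≤ C * sNorm φ) :
    ∃ u : Lp ℂ 2 (volume : Measure (Rd d)), T = (u : TD d) ∧ ‖u‖ ≤ C := by
  let e : 𝓢(Rd d, ℂ) →L[ℂ] Lp ℂ 2 (volume : Measure (Rd d)) :=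
    SchwartzMap.toLpCLM ℂ ℂ 2 volume
  have he : DenseRange e := SchwartzMap.denseRange_toLpCLM (by simp)
  let ℓ : Lp ℂ 2 (volume : Measure (Rd d)) →L[ℂ] ℂ :=
    LinearMap.extendOfNorm (T : 𝓢(Rd d, ℂ) →ₗ[ℂ] ℂ) (e : 𝓢(Rd d, ℂ) →ₗ[ℂ] _)
  have h1 : ∀ φ, ℓ (e φ) = T φ := fun φ =>
    LinearMap.extendOfNorm_eq he ⟨C, h⟩ φ
  have h2 : ∀ v, ‖ℓ v‖ ≤ C * ‖v‖ := fun v =>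
    LinearMap.norm_extendOfNorm_apply_le he C h v
  let w := (InnerProductSpace.toDual ℂ (Lp ℂ 2 (volume : Measure (Rd d)))).symm ℓ
  have hw : ‖w‖ ≤ C := by
    rw [LinearIsometryEquiv.norm_map]
    exact ContinuousLinearMap.opNorm_le_bound _ hC h2
  -- The distributional pairing is bilinear while the inner product conjugates its first slot; hence
  -- the conjugate of the Riesz vector.
  refine ⟨star w, ?_, (norm_star_Lp_le w).trans hw⟩
  ext φ
  rw [← h1 φ, ← InnerProductSpace.toDual_symm_apply, Lp.toTemperedDistribution_apply,
    L2.inner_def]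
  refine integral_congr_ae ?_
  filter_upwards [φ.coeFn_toLp 2 volume, Lp.coeFn_star w] with x a1 a2
  have : (e φ : Rd d → ℂ) x = φ x := a1
  rw [a2, this, Pi.star_apply]
  simp [w]

theorem memL2_of_bound {T : TD d} {C : ℝ} (hC : 0 ≤ C)
    (h : ∀ φ : 𝓢(Rd d, ℂ), ‖T φ‖ ≤ C * sNorm φ) :
    MemL2 T ∧ l2Norm T ≤ ENNReal.ofReal C := by
  obtain ⟨u, hu, hn⟩ := exists_Lp_of_bound hC h
  refine ⟨⟨u, hu⟩, ?_⟩
  rw [hu, l2Norm_coe, ← ofReal_norm]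
  exact ENNReal.ofReal_le_ofReal hn

theorem MemL2.exists_bound {T : TD d} (hT : MemL2 T) :
    ∃ A : ℝ, 0 ≤ A ∧ l2Norm T = ENNReal.ofReal A ∧ ∀ φ : 𝓢(Rd d, ℂ), ‖T φ‖ ≤ A * sNorm φ := by
  obtain ⟨u, rfl⟩ := hT
  exact ⟨‖u‖, norm_nonneg _, by rw [l2Norm_coe, ofReal_norm], norm_Lp_apply_le u⟩

/-! ### Bessel potentials of Schwartz functions -/

theorem besselSymbol_mul (s t : ℝ) (ξ : Rd d) :
    besselSymbol d s ξ * besselSymbol d t ξ = besselSymbol d (s + t) ξ := by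
  unfold besselSymbol
  rw [← Real.rpow_add (by positivity), add_div]

theorem besselSymbol_zero (ξ : Rd d) : besselSymbol d 0 ξ = 1 := by simp [besselSymbol]

theorem besselSymbol_two (ξ : Rd d) : besselSymbol d 2 ξ = 1 + (2 * π * ‖ξ‖) ^ 2 := by
  simp [besselSymbol]

theorem besselSymbol_mono {s t : ℝ} (h : s ≤ t) (ξ : Rd d) :
    besselSymbol d s ξ ≤ besselSymbol d t ξ := by
  unfold besselSymbol
  exact Real.rpow_le_rpow_of_exponent_le (by nlinarith [sq_nonneg (2 * π * ‖ξ‖)]) (by linarith)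

theorem one_le_besselSymbol {s : ℝ} (h : 0 ≤ s) (ξ : Rd d) : 1 ≤ besselSymbol d s ξ :=
  (besselSymbol_zero ξ).symm.le.trans (besselSymbol_mono h ξ)

theorem besselSymbol_le_one {s : ℝ} (h : s ≤ 0) (ξ : Rd d) : besselSymbol d s ξ ≤ 1 :=
  (besselSymbol_mono h ξ).trans (besselSymbol_zero ξ).le

theorem norm_ofReal_besselSymbol (s : ℝ) (ξ : Rd d) :
    ‖(besselSymbol d s ξ : ℂ)‖ = besselSymbol d s ξ := by
  rw [Complex.norm_real, Real.norm_of_nonneg (besselSymbol_pos s ξ).le]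

theorem norm_le_besselSymbol_one (ξ : Rd d) : 2 * π * ‖ξ‖ ≤ besselSymbol d 1 ξ := by
  refine abs_le_of_sq_le_sq' ?_ (besselSymbol_pos 1 ξ).le |>.2
  rw [sq (besselSymbol d 1 ξ), besselSymbol_mul, show (1 : ℝ) + 1 = 2 by norm_num,
    besselSymbol_two]
  linarith

theorem besselSymbol_one_le (ξ : Rd d) : besselSymbol d 1 ξ ≤ 1 + 2 * π * ‖ξ‖ := by
  have h0 : 0 ≤ 2 * π * ‖ξ‖ := by positivity
  refine abs_le_of_sq_le_sq' ?_ (by positivity) |>.2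
  rw [sq (besselSymbol d 1 ξ), besselSymbol_mul, show (1 : ℝ) + 1 = 2 by norm_num,
    besselSymbol_two]
  nlinarith

/-- The Bessel operator on Schwartz functions. -/
def sJ (s : ℝ) : 𝓢(Rd d, ℂ) →L[ℂ] 𝓢(Rd d, ℂ) := mulF (fun ξ => (besselSymbol d s ξ : ℂ))

theorem sJ_sJ (s t : ℝ) (φ : 𝓢(Rd d, ℂ)) : sJ s (sJ t φ) = sJ (s + t) φ := by
  rw [sJ, sJ, mulF_mulF (besselSymbol_hasTemperateGrowth s) (besselSymbol_hasTemperateGrowth t)]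
  simp_rw [← Complex.ofReal_mul, besselSymbol_mul]
  rfl

theorem sJ_zero (φ : 𝓢(Rd d, ℂ)) : sJ 0 φ = φ := by
  rw [sJ]
  simp_rw [besselSymbol_zero]
  exact mulF_one φ

theorem sNorm_sJ_mono {s t : ℝ} (h : s ≤ t) (φ : 𝓢(Rd d, ℂ)) :
    sNorm (sJ s φ) ≤ sNorm (sJ t φ) := by
  refine (sNorm_mulF_le (besselSymbol_hasTemperateGrowth s) (besselSymbol_hasTemperateGrowth t)
    (C := 1) (fun ξ => ?_) φ).trans (one_mul _).le
  rw [norm_ofReal_besselSymbol, norm_ofReal_besselSymbol, one_mul]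
  exact besselSymbol_mono h ξ

theorem sInner_sJ (s : ℝ) (φ ψ : 𝓢(Rd d, ℂ)) : sInner φ (sJ s ψ) = sInner (sJ s φ) ψ :=
  sInner_mulF (besselSymbol_hasTemperateGrowth s) φ ψ

/-! ### Multiplication by smooth functions with bounded derivatives -/

/-- A smooth real function which is bounded together with all its derivatives. -/
structure BddSmooth (θ : Rd d → ℝ) : Prop where
  smooth : ContDiff ℝ ∞ θ
  bounded : ∀ n : ℕ, ∃ C : ℝ, ∀ x, ‖iteratedFDeriv ℝ n θ x‖ ≤ C

theorem IsCutoff.bddSmooth {θ : Rd d → ℝ} (h : IsCutoff θ) : BddSmooth θ :=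
  ⟨h.smooth, h.bounded_deriv⟩

theorem BddSmooth.hasTemperateGrowth {θ : Rd d → ℝ} (h : BddSmooth θ) :
    (fun x : Rd d => (θ x : ℂ)).HasTemperateGrowth := by
  have : θ.HasTemperateGrowth := by
    refine ⟨h.smooth, fun n => ?_⟩
    obtain ⟨C, hC⟩ := h.bounded n
    exact ⟨0, C, fun x => by simpa using hC x⟩
  fun_prop

theorem BddSmooth.one_sub {θ : Rd d → ℝ} (h : BddSmooth θ) : BddSmooth (fun x => 1 - θ x) := by
  refine ⟨contDiff_const.sub h.smooth, fun n => ?_⟩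
  obtain ⟨C, hC⟩ := h.bounded n
  obtain ⟨D, hD⟩ : ∃ D : ℝ, ∀ x : Rd d, ‖iteratedFDeriv ℝ n (fun _ => (1 : ℝ)) x‖ ≤ D := by
    rcases Nat.eq_zero_or_pos n with rfl | hn
    · exact ⟨1, fun x => by simp⟩
    · exact ⟨0, fun x => by rw [iteratedFDeriv_const_of_ne hn.ne']; simp⟩
  refine ⟨D + C, fun x => ?_⟩
  have e : iteratedFDeriv ℝ n (fun x => 1 - θ x) x =
      iteratedFDeriv ℝ n (fun _ => (1 : ℝ)) x - iteratedFDeriv ℝ n θ x :=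
    iteratedFDeriv_sub_apply (contDiff_const.contDiffAt)
      ((h.smooth.of_le (mod_cast le_top)).contDiffAt)
  rw [e]
  exact (norm_sub_le _ _).trans (add_le_add (hD x) (hC x))

theorem BddSmooth.fderiv_apply {θ : Rd d → ℝ} (h : BddSmooth θ) (v : Rd d) :
    BddSmooth (fun x => fderiv ℝ θ x v) := by
  have hs : ContDiff ℝ ∞ (fderiv ℝ θ) := h.smooth.fderiv_right (by simp)
  refine ⟨by fun_prop, fun n => ?_⟩
  obtain ⟨C, hC⟩ := h.bounded (n + 1)
  refine ⟨‖v‖ * C, fun x => ?_⟩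
  refine (norm_iteratedFDeriv_clm_apply_const (N := n)
    (hs.of_le (mod_cast le_top)).contDiffAt le_rfl).trans ?_
  rw [norm_iteratedFDeriv_fderiv]
  exact mul_le_mul_of_nonneg_left (hC x) (norm_nonneg _)

theorem BddSmooth.exists_norm_le {θ : Rd d → ℝ} (h : BddSmooth θ) :
    ∃ C : ℝ, 0 ≤ C ∧ ∀ x, ‖(θ x : ℂ)‖ ≤ C := by
  obtain ⟨C, hC⟩ := h.bounded 0
  refine ⟨C, (norm_nonneg _).trans (hC 0), fun x => ?_⟩
  simpa using hC x

/-- Multiplication by a smooth real function. -/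
abbrev smulR (θ : Rd d → ℝ) : 𝓢(Rd d, ℂ) →L[ℂ] 𝓢(Rd d, ℂ) := smulS fun x => (θ x : ℂ)

/-- Multiplication by `θ` is bounded on the Sobolev space of order `s`. -/
def SobolevBounded (s : ℝ) (θ : Rd d → ℝ) : Prop :=
  ∃ C : ℝ, 0 ≤ C ∧ ∀ φ : 𝓢(Rd d, ℂ), sNorm (sJ s (smulR θ φ)) ≤ C * sNorm (sJ s φ)

open LineDeriv in
theorem lineDeriv_smulR {θ : Rd d → ℝ} (h : BddSmooth θ) (v : Rd d) (φ : 𝓢(Rd d, ℂ)) :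
    ∂_{v} (smulR θ φ) = smulR (fun x => fderiv ℝ θ x v) φ + smulR θ (∂_{v} φ) := by
  ext x
  have hθ : DifferentiableAt ℝ θ x := h.smooth.differentiable (by simp) x
  have e : (smulR θ φ : Rd d → ℂ) = fun y => θ y • φ y := by
    ext y
    rw [smulS_apply h.hasTemperateGrowth, Complex.real_smul]
  rw [SchwartzMap.lineDerivOp_apply_eq_fderiv, e, fderiv_fun_smul hθ φ.differentiableAt,
    add_apply, add_apply, smulS_apply (h.fderiv_apply v).hasTemperateGrowth,
    smulS_apply h.hasTemperateGrowth, SchwartzMap.lineDerivOp_apply_eq_fderiv]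
  simp [add_comm]

open LineDeriv in
theorem norm_fourierInv_lineDeriv (v : Rd d) (φ : 𝓢(Rd d, ℂ)) (ξ : Rd d) :
    ‖𝓕⁻ (∂_{v} φ) ξ‖ = 2 * π * |inner ℝ ξ v| * ‖𝓕⁻ φ ξ‖ := by
  rw [SchwartzMap.fourierInv_lineDerivOp_eq, smul_apply,
    SchwartzMap.smulLeftCLM_apply_apply (by fun_prop)]
  simp [abs_of_pos Real.pi_pos, mul_assoc]

theorem norm_smulS_besselSymbol (s : ℝ) (φ : 𝓢(Rd d, ℂ)) (ξ : Rd d) :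
    ‖smulS (fun ξ => (besselSymbol d s ξ : ℂ)) φ ξ‖ = besselSymbol d s ξ * ‖φ ξ‖ := by
  rw [smulS_apply (besselSymbol_hasTemperateGrowth s), norm_mul, norm_ofReal_besselSymbol]

open LineDeriv in
theorem sNorm_sJ_lineDeriv_le (s : ℝ) {v : Rd d} (hv : ‖v‖ ≤ 1) (φ : 𝓢(Rd d, ℂ)) :
    sNorm (sJ s (∂_{v} φ)) ≤ sNorm (sJ (s + 1) φ) := by
  rw [sJ, sJ, sNorm_mulF, sNorm_mulF]
  refine (sNorm_le_of_norm_le (C := 1) fun ξ => ?_).trans (one_mul _).le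
  rw [norm_smulS_besselSymbol, norm_smulS_besselSymbol, norm_fourierInv_lineDeriv, one_mul,
    ← mul_assoc, ← besselSymbol_mul]
  have h1 : |inner ℝ ξ v| ≤ ‖ξ‖ := (abs_real_inner_le_norm ξ v).trans
    (mul_le_of_le_one_right (norm_nonneg _) hv)
  have h2 : 2 * π * |inner ℝ ξ v| ≤ besselSymbol d 1 ξ :=
    (mul_le_mul_of_nonneg_left h1 (by positivity)).trans (norm_le_besselSymbol_one ξ)
  have := (besselSymbol_pos s ξ).le
  gcongr

-- On the Fourier side this is ⟨ξ⟩ ≤ 1 + 2π ∑ |ξ_j|. Indexing by `Option (Fin d)` treats `φ` itself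
-- as one more term of the sum.
open LineDeriv in
theorem sNorm_sJ_add_one_le (s : ℝ) (φ : 𝓢(Rd d, ℂ)) :
    sNorm (sJ (s + 1) φ) ≤
      sNorm (sJ s φ) + ∑ j : Fin d, sNorm (sJ s (∂_{EuclideanSpace.single j (1 : ℝ)} φ)) := by
  let ψ : Option (Fin d) → 𝓢(Rd d, ℂ) := fun o =>
    o.elim φ fun j => ∂_{EuclideanSpace.single j (1 : ℝ)} φ
  have key : sNorm (sJ (s + 1) φ) ≤ ∑ o : Option (Fin d), sNorm (sJ s (ψ o)) := by
    simp_rw [sJ, sNorm_mulF]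
    refine sNorm_le_sum _ fun ξ => ?_
    simp_rw [norm_smulS_besselSymbol]
    rw [Fintype.sum_option]
    simp only [ψ, Option.elim, norm_fourierInv_lineDeriv, EuclideanSpace.inner_single_right]
    rw [← besselSymbol_mul, mul_assoc, ← Finset.mul_sum, ← mul_add, ← Finset.sum_mul,
      ← Finset.mul_sum, ← one_add_mul]
    refine mul_le_mul_of_nonneg_left ?_ (besselSymbol_pos s ξ).le
    refine mul_le_mul_of_nonneg_right ((besselSymbol_one_le ξ).trans ?_) (norm_nonneg _)
    have : ‖ξ‖ ≤ ∑ j : Fin d, |ξ j| := by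
      calc ‖ξ‖ = ‖∑ j : Fin d, ξ j • EuclideanSpace.basisFun (Fin d) ℝ j‖ := by
            congr 1
            exact ((EuclideanSpace.basisFun (Fin d) ℝ).sum_repr ξ).symm
        _ ≤ _ := (norm_sum_le _ _).trans (by simp [norm_smul])
    simp only [one_mul, conj_trivial]
    gcongr
  refine key.trans ?_
  rw [Fintype.sum_option]
  rfl

-- Product rule: a derivative falls on `φ` or on `θ`. The hypothesis ranges over all multipliers
-- because the derivatives of `θ` act as multipliers too.
open LineDeriv in
theorem SobolevBounded.add_one {s : ℝ} (hs : ∀ θ : Rd d → ℝ, BddSmooth θ → SobolevBounded s θ)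
    {θ : Rd d → ℝ} (hθ : BddSmooth θ) : SobolevBounded (s + 1) θ := by
  obtain ⟨C, hC0, hC⟩ := hs θ hθ
  choose D hD0 hD using fun j : Fin d => hs _ (hθ.fderiv_apply (EuclideanSpace.single j (1 : ℝ)))
  refine ⟨C + ∑ j, (D j + C), add_nonneg hC0 (Finset.sum_nonneg fun j _ => add_nonneg (hD0 j) hC0),
    fun φ => (sNorm_sJ_add_one_le s _).trans ?_⟩
  have hm := sNorm_sJ_mono (show s ≤ s + 1 by linarith) φ
  rw [add_mul, Finset.sum_mul]
  refine add_le_add ((hC φ).trans (mul_le_mul_of_nonneg_left hm hC0))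
    (Finset.sum_le_sum fun j _ => ?_)
  rw [lineDeriv_smulR hθ, map_add, add_mul]
  refine (sNorm_add_le _ _).trans (add_le_add ?_ ?_)
  · exact (hD j φ).trans (mul_le_mul_of_nonneg_left hm (hD0 j))
  · exact (hC _).trans (mul_le_mul_of_nonneg_left (sNorm_sJ_lineDeriv_le s (by simp) φ) hC0)

theorem SobolevBounded.zero {θ : Rd d → ℝ} (hθ : BddSmooth θ) : SobolevBounded 0 θ := by
  obtain ⟨C, hC0, hC⟩ := hθ.exists_norm_le
  refine ⟨C, hC0, fun φ => ?_⟩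
  rw [sJ_zero, sJ_zero]
  exact sNorm_smulS_le_of_bounded hθ.hasTemperateGrowth hC φ

/-- Duality: J^{-s} θ J^s is the adjoint of J^s θ J^{-s}. Concretely, ψ = J^{-s}(θ φ) is paired with
itself, the operators are moved across, and one factor ‖ψ‖ is cancelled. -/
theorem SobolevBounded.neg {s : ℝ} {θ : Rd d → ℝ} (hθ : BddSmooth θ) (h : SobolevBounded s θ) :
    SobolevBounded (-s) θ := by
  obtain ⟨C, hC0, hC⟩ := h
  refine ⟨C, hC0, fun φ => ?_⟩
  obtain ⟨ψ, hψ⟩ : ∃ ψ, ψ = sJ (-s) (smulR θ φ) := ⟨_, rfl⟩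
  have hφ : φ = sJ s (sJ (-s) φ) := by rw [sJ_sJ, add_neg_cancel, sJ_zero]
  rw [← hψ]
  have e : sInner ψ ψ = sInner (sJ s (smulR θ (sJ (-s) ψ))) (sJ (-s) φ) := by
    nth_rw 2 [hψ]
    rw [sInner_sJ, sInner_smulS hθ.hasTemperateGrowth, ← sInner_sJ s, ← hφ]
  have h2 : sNorm ψ * sNorm ψ ≤ C * sNorm (sJ (-s) φ) * sNorm ψ := by
    rw [← sq, ← norm_sInner_self, e]
    refine (norm_sInner_le _ _).trans ?_
    have := hC (sJ (-s) ψ)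
    rw [sJ_sJ, add_neg_cancel, sJ_zero] at this
    nlinarith [sNorm_nonneg (sJ (-s) φ)]
  rcases (sNorm_nonneg ψ).eq_or_lt with h0 | h0
  · rw [← h0]
    exact mul_nonneg hC0 (sNorm_nonneg _)
  · exact le_of_mul_le_mul_right h2 h0

/-! ### Interpolation between `L²` and `H¹` -/

/-- The symbol `(1 + t ⟨ξ⟩²)⁻¹` of a resolvent of the Laplacian. -/
def resolventSymbol (d : ℕ) (t : ℝ) (ξ : Rd d) : ℝ := (1 + t * besselSymbol d 2 ξ)⁻¹

theorem resolventSymbol_hasTemperateGrowth {t : ℝ} (ht : 0 < t) :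
    (fun ξ : Rd d => (resolventSymbol d t ξ : ℂ)).HasTemperateGrowth := by
  -- The dilation is chosen so that 1 + t⟨ξ⟩² = (1 + t)(1 + |cξ|²), with c = 2π√(t/(1+t)).
  have h1 : (fun ξ : Rd d => (2 * π * √(t / (1 + t))) • ξ).HasTemperateGrowth := by fun_prop
  have h2 := (Function.hasTemperateGrowth_one_add_norm_sq_rpow (Rd d) (-1)).comp h1
  have h3 : (fun ξ : Rd d => resolventSymbol d t ξ).HasTemperateGrowth := by
    have e : (fun ξ : Rd d => resolventSymbol d t ξ) = fun ξ => (1 + t)⁻¹ *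
        ((fun x : Rd d => (1 + ‖x‖ ^ 2) ^ (-1 : ℝ)) ∘
          fun ξ => (2 * π * √(t / (1 + t))) • ξ) ξ := by
      funext ξ
      simp only [Function.comp_apply, Real.rpow_neg_one, resolventSymbol, besselSymbol_two]
      rw [← mul_inv]
      congr 1
      have h : (2 * π * √(t / (1 + t)) * ‖ξ‖) ^ 2 = (2 * π * ‖ξ‖) ^ 2 * (t / (1 + t)) := by
        rw [mul_right_comm, mul_pow _ (√_), Real.sq_sqrt (by positivity)]
      rw [norm_smul, Real.norm_of_nonneg (by positivity), h]
      field_simp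
      ring
    rw [e]
    fun_prop
  fun_prop

/-- The squared norm of the K-functional of the couple `(L², H¹)`. -/
def kFunctional (t : ℝ) (φ : 𝓢(Rd d, ℂ)) : ℝ≥0∞ :=
  ∫⁻ ξ, ENNReal.ofReal (t * besselSymbol d 2 ξ * resolventSymbol d t ξ * ‖𝓕⁻ φ ξ‖ ^ 2)

theorem ofReal_sNorm_sJ_sq (s : ℝ) (φ : 𝓢(Rd d, ℂ)) :
    ENNReal.ofReal (sNorm (sJ s φ) ^ 2) =
      ∫⁻ ξ, ENNReal.ofReal (besselSymbol d 2 ξ ^ s * ‖𝓕⁻ φ ξ‖ ^ 2) := by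
  rw [sJ, sNorm_mulF, ofReal_sNorm_sq]
  congr 1
  ext ξ
  rw [norm_smulS_besselSymbol, mul_pow]
  congr 2
  rw [besselSymbol, besselSymbol, ← Real.rpow_natCast, ← Real.rpow_mul (by positivity),
    ← Real.rpow_mul (by positivity)]
  congr 1
  push_cast
  ring

theorem resolventSymbol_pos {t : ℝ} (ht : 0 < t) (ξ : Rd d) : 0 < resolventSymbol d t ξ := by
  have := besselSymbol_pos 2 ξ
  unfold resolventSymbol
  positivity

theorem continuous_besselSymbol (s : ℝ) : Continuous fun ξ : Rd d => besselSymbol d s ξ := by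
  unfold besselSymbol
  exact Continuous.rpow_const (by fun_prop) fun ξ => Or.inl (by positivity)

theorem kFunctional_le_sNorm_sq {t : ℝ} (ht : 0 < t) (φ : 𝓢(Rd d, ℂ)) :
    kFunctional t φ ≤ ENNReal.ofReal (sNorm φ ^ 2) := by
  rw [← sNorm_fourierInv, ofReal_sNorm_sq]
  refine lintegral_mono fun ξ => ENNReal.ofReal_le_ofReal ?_
  have := besselSymbol_pos 2 ξ
  refine mul_le_of_le_one_left (by positivity) ?_
  rw [resolventSymbol, ← div_eq_mul_inv, div_le_one (by positivity)]
  linarith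

theorem kFunctional_le_sNorm_sJ_sq {t : ℝ} (ht : 0 < t) (φ : 𝓢(Rd d, ℂ)) :
    kFunctional t φ ≤ ENNReal.ofReal (t * sNorm (sJ 1 φ) ^ 2) := by
  rw [ENNReal.ofReal_mul ht.le, ofReal_sNorm_sJ_sq, ← lintegral_const_mul' _ _ (by simp)]
  refine lintegral_mono fun ξ => ?_
  rw [← ENNReal.ofReal_mul ht.le]
  refine ENNReal.ofReal_le_ofReal ?_
  have := besselSymbol_pos 2 ξ
  rw [Real.rpow_one, ← mul_assoc]
  refine mul_le_mul_of_nonneg_right (mul_le_of_le_one_right (by positivity) ?_) (by positivity)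
  exact inv_le_one_of_one_le₀ (by nlinarith)

theorem kFunctional_add_le {t : ℝ} (ht : 0 < t) (φ ψ : 𝓢(Rd d, ℂ)) :
    kFunctional t (φ + ψ) ≤
      ENNReal.ofReal 2 * kFunctional t φ + ENNReal.ofReal 2 * kFunctional t ψ := by
  have hm : ∀ χ : 𝓢(Rd d, ℂ), Measurable fun ξ =>
      ENNReal.ofReal (t * besselSymbol d 2 ξ * resolventSymbol d t ξ * ‖𝓕⁻ χ ξ‖ ^ 2) := by
    intro χ
    have h1 := (continuous_besselSymbol (d := d) 2).measurable
    have h2 := (𝓕⁻ χ).continuous.measurable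
    unfold resolventSymbol
    fun_prop
  unfold kFunctional
  rw [← lintegral_const_mul _ (hm φ), ← lintegral_const_mul _ (hm ψ),
    ← lintegral_add_left ((hm φ).const_mul _)]
  refine lintegral_mono fun ξ => ?_
  have h1 := besselSymbol_pos 2 ξ
  have h2 := resolventSymbol_pos ht ξ
  rw [← ENNReal.ofReal_mul (by norm_num),
    ← ENNReal.ofReal_mul (by norm_num), ← ENNReal.ofReal_add (by positivity) (by positivity)]
  refine ENNReal.ofReal_le_ofReal ?_
  have h3 : ‖𝓕⁻ (φ + ψ) ξ‖ ^ 2 ≤ 2 * ‖𝓕⁻ φ ξ‖ ^ 2 + 2 * ‖𝓕⁻ ψ ξ‖ ^ 2 := by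
    rw [FourierTransform.fourierInv_add, add_apply]
    have := norm_add_le (𝓕⁻ φ ξ) (𝓕⁻ ψ ξ)
    nlinarith [norm_nonneg (𝓕⁻ φ ξ + 𝓕⁻ ψ ξ), sq_nonneg (‖𝓕⁻ φ ξ‖ - ‖𝓕⁻ ψ ξ‖)]
  calc _ ≤ t * besselSymbol d 2 ξ * resolventSymbol d t ξ *
        (2 * ‖𝓕⁻ φ ξ‖ ^ 2 + 2 * ‖𝓕⁻ ψ ξ‖ ^ 2) := by gcongr
    _ = _ := by ring

/-- The splitting of `φ` that attains the K-functional. -/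
theorem exists_kFunctional_decomposition {t : ℝ} (ht : 0 < t) (φ : 𝓢(Rd d, ℂ)) :
    ∃ φ₀ φ₁ : 𝓢(Rd d, ℂ), φ = φ₀ + φ₁ ∧
      ENNReal.ofReal (sNorm φ₀ ^ 2) + ENNReal.ofReal (t * sNorm (sJ 1 φ₁) ^ 2) =
        kFunctional t φ := by
  have hr := resolventSymbol_hasTemperateGrowth (d := d) ht
  have hsub : ∀ ψ : 𝓢(Rd d, ℂ), 𝓕⁻ (φ - ψ) = 𝓕⁻ φ - 𝓕⁻ ψ :=
    map_sub (fourierInvCLM ℂ 𝓢(Rd d, ℂ)) φ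
  have hF : 𝓕⁻ (mulF (fun ξ => (resolventSymbol d t ξ : ℂ)) φ) =
      smulS (fun ξ => (resolventSymbol d t ξ : ℂ)) (𝓕⁻ φ) := fourierInv_mulF _ φ
  -- Frequency by frequency, |a₀|² + t⟨ξ⟩²|a₁|² under a₀ + a₁ = a is least at a₁ = a/(1 + t⟨ξ⟩²).
  refine ⟨φ - mulF (fun ξ => (resolventSymbol d t ξ : ℂ)) φ,
    mulF (fun ξ => (resolventSymbol d t ξ : ℂ)) φ, by simp, ?_⟩
  have h1 := (continuous_besselSymbol (d := d) 2).measurable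
  have h2 := (𝓕⁻ φ).continuous.measurable
  rw [ENNReal.ofReal_mul ht.le, ofReal_sNorm_sJ_sq, ← lintegral_const_mul' _ _ (by simp),
    ← sNorm_fourierInv, ofReal_sNorm_sq, hsub, hF]
  rw [← lintegral_add_left]
  · unfold kFunctional
    congr 1
    ext ξ
    have h1 := besselSymbol_pos 2 ξ
    rw [← ENNReal.ofReal_mul ht.le, ← ENNReal.ofReal_add (by positivity) (by positivity),
      sub_apply, smulS_apply hr]
    congr 1
    have e : 𝓕⁻ φ ξ - (resolventSymbol d t ξ : ℂ) * 𝓕⁻ φ ξ =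
        ((1 - resolventSymbol d t ξ : ℝ) : ℂ) * 𝓕⁻ φ ξ := by push_cast; ring
    rw [e, norm_mul, norm_mul, mul_pow, mul_pow, Complex.norm_real, Complex.norm_real,
      Real.norm_eq_abs, Real.norm_eq_abs, sq_abs, sq_abs, Real.rpow_one, resolventSymbol]
    field_simp
    ring
  · simp_rw [sub_apply, smulS_apply hr]
    unfold resolventSymbol
    fun_prop

/-- Apply `A` to the two pieces of the optimal splitting and estimate each in its own space. The
factor 2 comes from |a + b|² ≤ 2|a|² + 2|b|². -/
theorem kFunctional_le_of_bounded {A : 𝓢(Rd d, ℂ) →L[ℂ] 𝓢(Rd d, ℂ)} {C : ℝ}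
    (h0 : ∀ φ, sNorm (A φ) ≤ C * sNorm φ) (h1 : ∀ φ, sNorm (sJ 1 (A φ)) ≤ C * sNorm (sJ 1 φ))
    {t : ℝ} (ht : 0 < t) (φ : 𝓢(Rd d, ℂ)) :
    kFunctional t (A φ) ≤ ENNReal.ofReal (2 * C ^ 2) * kFunctional t φ := by
  obtain ⟨φ₀, φ₁, hφ, hk⟩ := exists_kFunctional_decomposition ht φ
  rw [← hk, hφ, map_add]
  refine (kFunctional_add_le ht _ _).trans ?_
  rw [mul_add]
  refine add_le_add ?_ ?_
  · rw [← ENNReal.ofReal_mul (by positivity)]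
    refine (mul_le_mul_right (kFunctional_le_sNorm_sq ht _) _).trans ?_
    rw [← ENNReal.ofReal_mul (by norm_num)]
    refine ENNReal.ofReal_le_ofReal ?_
    rw [mul_assoc, ← mul_pow]
    have := sNorm_nonneg (A φ₀)
    have := h0 φ₀
    gcongr
  · rw [← ENNReal.ofReal_mul (by positivity)]
    refine (mul_le_mul_right (kFunctional_le_sNorm_sJ_sq ht _) _).trans ?_
    rw [← ENNReal.ofReal_mul (by norm_num)]
    refine ENNReal.ofReal_le_ofReal ?_
    rw [mul_assoc, mul_left_comm (C ^ 2) t, ← mul_pow]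
    have := sNorm_nonneg (sJ 1 (A φ₁))
    have := h1 φ₁
    gcongr

/-- Near 0 the integrand is at most u^{-s}, integrable as s < 1; beyond 1 it is at most u^{-s-1},
integrable as s > 0. -/
theorem integrableOn_rpow_neg_div_one_add {s : ℝ} (h0 : 0 < s) (h1 : s < 1) :
    IntegrableOn (fun u : ℝ => u ^ (-s) / (1 + u)) (Set.Ioi 0) := by
  have hm : Measurable fun u : ℝ => u ^ (-s) / (1 + u) := by fun_prop
  rw [← Set.Ioc_union_Ioi_eq_Ioi zero_le_one]
  refine IntegrableOn.union ?_ ?_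
  · have h := (intervalIntegral.intervalIntegrable_rpow' (a := 0) (b := 1)
      (show -1 < -s by linarith)).1
    refine Integrable.mono' h hm.aestronglyMeasurable ?_
    refine (ae_restrict_iff' measurableSet_Ioc).2 (Filter.Eventually.of_forall fun u hu => ?_)
    have := hu.1
    rw [Real.norm_of_nonneg (by positivity)]
    exact div_le_self (by positivity) (by linarith)
  · have h := integrableOn_Ioi_rpow_of_lt (show -s - 1 < -1 by linarith) zero_lt_one
    refine Integrable.mono' h hm.aestronglyMeasurable ?_
    refine (ae_restrict_iff' measurableSet_Ioi).2 (Filter.Eventually.of_forall fun u hu => ?_)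
    have hu0 : (0 : ℝ) < u := zero_lt_one.trans hu
    rw [Real.norm_of_nonneg (by positivity), Real.rpow_sub_one hu0.ne']
    gcongr
    linarith

/-- The substitution u = wt extracts the power w^s. With w = ⟨ξ⟩² this produces the squared weight
of the Sobolev norm of order `s`. -/
theorem lintegral_rpow_mul_resolvent {s : ℝ} (h0 : 0 < s) (h1 : s < 1) {w : ℝ} (hw : 0 < w) :
    ∫⁻ t in Set.Ioi (0 : ℝ), ENNReal.ofReal (t ^ (-s - 1) * (t * w * (1 + t * w)⁻¹)) =
      ENNReal.ofReal ((∫ u in Set.Ioi (0 : ℝ), u ^ (-s) / (1 + u)) * w ^ s) := by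
  have hi := integrableOn_rpow_neg_div_one_add h0 h1
  have e : ∀ t ∈ Set.Ioi (0 : ℝ), t ^ (-s - 1) * (t * w * (1 + t * w)⁻¹) =
      w ^ s * w * ((w * t) ^ (-s) / (1 + w * t)) := by
    intro t ht
    have ht0 : (0 : ℝ) < t := ht
    rw [Real.mul_rpow hw.le ht0.le, Real.rpow_sub_one ht0.ne', Real.rpow_neg hw.le,
      mul_comm w t]
    have := Real.rpow_pos_of_pos hw s
    field_simp
  rw [setLIntegral_congr_fun measurableSet_Ioi fun t ht => by rw [e t ht],
    ← ofReal_integral_eq_lintegral_ofReal]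
  · congr 1
    rw [integral_const_mul, integral_comp_mul_left_Ioi (fun u => u ^ (-s) / (1 + u)) 0 hw]
    simp only [mul_zero, smul_eq_mul]
    field_simp
  · refine Integrable.const_mul ?_ _
    have := (integrableOn_Ioi_comp_mul_left_iff (fun u : ℝ => u ^ (-s) / (1 + u)) 0 hw).2
      (by simpa using hi)
    exact this
  · refine (ae_restrict_iff' measurableSet_Ioi).2 (Filter.Eventually.of_forall fun t ht => ?_)
    have ht0 : (0 : ℝ) < t := ht
    simp only [Pi.zero_apply]
    positivity

theorem integral_rpow_neg_div_one_add_pos {s : ℝ} (h0 : 0 < s) (h1 : s < 1) :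
    0 < ∫ u in Set.Ioi (0 : ℝ), u ^ (-s) / (1 + u) := by
  rw [setIntegral_pos_iff_support_of_nonneg_ae]
  · have : Set.Ioi (0 : ℝ) ⊆ Function.support (fun u : ℝ => u ^ (-s) / (1 + u)) ∩ Set.Ioi 0 := by
      intro u hu
      have hu0 : (0 : ℝ) < u := hu
      refine ⟨?_, hu⟩
      rw [Function.mem_support]
      positivity
    refine lt_of_lt_of_le ?_ (measure_mono this)
    simp
  · refine (ae_restrict_iff' measurableSet_Ioi).2 (Filter.Eventually.of_forall fun t ht => ?_)
    have ht0 : (0 : ℝ) < t := ht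
    simp only [Pi.zero_apply]
    positivity
  · exact integrableOn_rpow_neg_div_one_add h0 h1

/-- By Tonelli the integral in `t` is done first, at fixed frequency. -/
theorem lintegral_kFunctional {s : ℝ} (h0 : 0 < s) (h1 : s < 1) (φ : 𝓢(Rd d, ℂ)) :
    ∫⁻ t in Set.Ioi (0 : ℝ), ENNReal.ofReal (t ^ (-s - 1)) * kFunctional t φ =
      ENNReal.ofReal (∫ u in Set.Ioi (0 : ℝ), u ^ (-s) / (1 + u)) *
        ENNReal.ofReal (sNorm (sJ s φ) ^ 2) := by
  have hc := (integral_rpow_neg_div_one_add_pos h0 h1).le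
  have b1 := (continuous_besselSymbol (d := d) 2).measurable
  have b2 := (𝓕⁻ φ).continuous.measurable
  rw [ofReal_sNorm_sJ_sq, ← lintegral_const_mul' _ _ (by simp)]
  simp_rw [← ENNReal.ofReal_mul hc]
  unfold kFunctional
  simp_rw [← lintegral_const_mul' (ENNReal.ofReal _) _ ENNReal.ofReal_ne_top]
  rw [lintegral_lintegral_swap]
  · congr 1
    ext ξ
    rw [← mul_assoc, ENNReal.ofReal_mul (by have := besselSymbol_pos 2 ξ; positivity),
      ← lintegral_rpow_mul_resolvent h0 h1 (besselSymbol_pos 2 ξ),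
      ← lintegral_mul_const' _ _ (by simp)]
    refine setLIntegral_congr_fun measurableSet_Ioi fun t ht => ?_
    have ht0 : (0 : ℝ) < t := ht
    have := besselSymbol_pos 2 ξ
    rw [← ENNReal.ofReal_mul (by positivity), ← ENNReal.ofReal_mul (by positivity), ← mul_assoc]
    rfl
  · unfold resolventSymbol
    fun_prop

/-- Real interpolation: the K-functional inequality holds for every `t`; integrating it against
t^{-s-1} and cancelling the positive constant gives the bound. -/
theorem SobolevBounded.of_lt_one {s : ℝ} (h0 : 0 < s) (h1 : s < 1) {θ : Rd d → ℝ}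
    (hθ : BddSmooth θ) : SobolevBounded s θ := by
  obtain ⟨C₀, hC₀, H₀⟩ := SobolevBounded.zero hθ
  obtain ⟨C₁, hC₁, H₁⟩ := SobolevBounded.add_one (fun _ => SobolevBounded.zero) hθ
  simp only [sJ_zero, zero_add] at H₀ H₁
  set C := C₀ + C₁ with hC
  have hC0 : 0 ≤ C := add_nonneg hC₀ hC₁
  have hc := integral_rpow_neg_div_one_add_pos h0 h1
  refine ⟨√(2 * C ^ 2), Real.sqrt_nonneg _, fun φ => ?_⟩
  have key : ENNReal.ofReal (sNorm (sJ s (smulR θ φ)) ^ 2) ≤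
      ENNReal.ofReal (2 * C ^ 2) * ENNReal.ofReal (sNorm (sJ s φ) ^ 2) := by
    have h := lintegral_mono_ae (μ := volume.restrict (Set.Ioi (0 : ℝ)))
      (f := fun t => ENNReal.ofReal (t ^ (-s - 1)) * kFunctional t (smulR θ φ))
      (g := fun t => ENNReal.ofReal (2 * C ^ 2) *
        (ENNReal.ofReal (t ^ (-s - 1)) * kFunctional t φ))
      ((ae_restrict_iff' measurableSet_Ioi).2 (Filter.Eventually.of_forall fun t ht => by
        rw [mul_left_comm]
        refine mul_le_mul_right (kFunctional_le_of_bounded (fun ψ => ?_) (fun ψ => ?_) ht φ) _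
        · refine (H₀ ψ).trans ?_
          have := sNorm_nonneg ψ
          gcongr
          linarith
        · refine (H₁ ψ).trans ?_
          have := sNorm_nonneg (sJ 1 ψ)
          gcongr
          linarith))
    rw [lintegral_const_mul' _ _ ENNReal.ofReal_ne_top, lintegral_kFunctional h0 h1,
      lintegral_kFunctional h0 h1, mul_left_comm] at h
    refine (ENNReal.mul_le_mul_iff_right ?_ ENNReal.ofReal_ne_top).1 h
    simpa using hc
  rw [← ENNReal.ofReal_mul (by positivity), ENNReal.ofReal_le_ofReal_iff (by positivity)] at key
  refine abs_le_of_sq_le_sq' ?_ (mul_nonneg (Real.sqrt_nonneg _) (sNorm_nonneg _)) |>.2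
  rwa [mul_pow, Real.sq_sqrt (by positivity)]

theorem BddSmooth.sobolevBounded_of_nonneg {s : ℝ} (hs : 0 ≤ s) {θ : Rd d → ℝ}
    (hθ : BddSmooth θ) : SobolevBounded s θ := by
  -- Here `σ` is the fractional part of `s`. The statement keeps `θ` universal so that the induction
  -- on `n` can use its derivatives.
  have key : ∀ n : ℕ, ∀ σ : ℝ, 0 ≤ σ → σ < 1 → ∀ θ : Rd d → ℝ, BddSmooth θ →
      SobolevBounded (σ + n) θ := by
    intro n σ h0 h1
    induction n with
    | zero =>
      intro θ hθ
      rcases h0.eq_or_lt with rfl | h0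
      · simpa using SobolevBounded.zero hθ
      · simpa using SobolevBounded.of_lt_one h0 h1 hθ
    | succ n ih =>
      intro θ hθ
      rw [Nat.cast_add_one, ← add_assoc]
      exact SobolevBounded.add_one ih hθ
  have := key ⌊s⌋₊ (s - ⌊s⌋₊) (sub_nonneg.2 (Nat.floor_le hs))
    (by linarith [Nat.lt_floor_add_one s]) θ hθ
  simpa using this

/-- Smooth functions with bounded derivatives are multipliers of every Sobolev space. -/
theorem BddSmooth.sobolevBounded {θ : Rd d → ℝ} (hθ : BddSmooth θ) (s : ℝ) :
    SobolevBounded s θ := by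
  rcases le_total 0 s with hs | hs
  · exact hθ.sobolevBounded_of_nonneg hs
  · simpa using (hθ.sobolevBounded_of_nonneg (neg_nonneg.2 hs)).neg hθ

/-! ### Symbol classes -/

/-- The classical symbol class of order `t`. -/
def IsSymbol {F : Type*} [NormedAddCommGroup F] [NormedSpace ℝ F] (t : ℝ) (a : Rd d → F) : Prop :=
  ContDiff ℝ ∞ a ∧ ∀ k : ℕ, ∃ C : ℝ, ∀ ξ, ‖iteratedFDeriv ℝ k a ξ‖ ≤ C * besselSymbol d (t - k) ξ

theorem nonneg_of_norm_le_mul_besselSymbol {G : Type*} [NormedAddCommGroup G] {C s : ℝ}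
    {ξ : Rd d} {x : G} (h : ‖x‖ ≤ C * besselSymbol d s ξ) : 0 ≤ C :=
  nonneg_of_mul_nonneg_left ((norm_nonneg _).trans h) (besselSymbol_pos s ξ)

section Symbol

variable {F : Type*} [NormedAddCommGroup F] [NormedSpace ℝ F] {t : ℝ} {a : Rd d → F}

theorem IsSymbol.exists_bound (h : IsSymbol t a) (k : ℕ) :
    ∃ C : ℝ, 0 ≤ C ∧ ∀ ξ, ‖iteratedFDeriv ℝ k a ξ‖ ≤ C * besselSymbol d (t - k) ξ := by
  obtain ⟨C, hC⟩ := h.2 k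
  exact ⟨C, nonneg_of_norm_le_mul_besselSymbol (hC 0), hC⟩

theorem IsSymbol.exists_uniform_bound (h : IsSymbol t a) (n : ℕ) :
    ∃ C : ℝ, 0 ≤ C ∧ ∀ k ≤ n, ∀ ξ,
      ‖iteratedFDeriv ℝ k a ξ‖ ≤ C * besselSymbol d (t - k) ξ := by
  choose C hC0 hC using h.exists_bound
  refine ⟨∑ k ∈ Finset.range (n + 1), C k, Finset.sum_nonneg fun k _ => hC0 k,
    fun k hk ξ => (hC k ξ).trans ?_⟩
  exact mul_le_mul_of_nonneg_right
    (Finset.single_le_sum (fun i _ => hC0 i) (Finset.mem_range.2 (Nat.lt_succ_of_le hk)))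
    (besselSymbol_pos _ ξ).le

theorem IsSymbol.exists_norm_le (h : IsSymbol t a) :
    ∃ C : ℝ, 0 ≤ C ∧ ∀ ξ, ‖a ξ‖ ≤ C * besselSymbol d t ξ := by
  obtain ⟨C, hC0, hC⟩ := h.exists_bound 0
  exact ⟨C, hC0, fun ξ => by simpa using hC ξ⟩

theorem IsSymbol.mono {t' : ℝ} (h : IsSymbol t a) (ht : t ≤ t') : IsSymbol t' a := by
  refine ⟨h.1, fun k => ?_⟩
  obtain ⟨C, hC0, hC⟩ := h.exists_bound k
  exact ⟨C, fun ξ => (hC ξ).trans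
    (mul_le_mul_of_nonneg_left (besselSymbol_mono (by linarith) ξ) hC0)⟩

theorem IsSymbol.fderiv (h : IsSymbol t a) : IsSymbol (t - 1) (fderiv ℝ a) := by
  refine ⟨h.1.fderiv_right (by simp), fun k => ?_⟩
  obtain ⟨C, hC⟩ := h.2 (k + 1)
  refine ⟨C, fun ξ => ?_⟩
  rw [norm_iteratedFDeriv_fderiv]
  have := hC ξ
  push_cast at this
  rwa [show t - 1 - (k : ℝ) = t - (k + 1) by ring]

/-- Lets a symbol be recognized by its size and its gradient alone, without computing higher
derivatives. -/
theorem IsSymbol.of_fderiv (hd : Differentiable ℝ a) (h' : IsSymbol (t - 1) (_root_.fderiv ℝ a))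
    {C : ℝ} (hC : ∀ ξ, ‖a ξ‖ ≤ C * besselSymbol d t ξ) : IsSymbol t a := by
  refine ⟨contDiff_infty_iff_fderiv.2 ⟨hd, h'.1⟩, fun k => ?_⟩
  cases k with
  | zero => exact ⟨C, fun ξ => by simpa using hC ξ⟩
  | succ k =>
    obtain ⟨C', hC'⟩ := h'.2 k
    refine ⟨C', fun ξ => ?_⟩
    rw [← norm_iteratedFDeriv_fderiv]
    convert hC' ξ using 3
    push_cast
    ring

theorem isSymbol_zero : IsSymbol t (fun _ : Rd d => (0 : F)) :=
  ⟨contDiff_const, fun k => ⟨0, fun ξ => by simp⟩⟩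

theorem isSymbol_const (c : F) : IsSymbol 0 (fun _ : Rd d => c) := by
  refine IsSymbol.of_fderiv (C := ‖c‖) (differentiable_const c) ?_ fun ξ => ?_
  · simpa using! isSymbol_zero
  · rw [besselSymbol_zero, mul_one]

theorem norm_le_besselSymbol_one' (ξ : Rd d) : ‖ξ‖ ≤ besselSymbol d 1 ξ := by
  refine le_trans ?_ (norm_le_besselSymbol_one ξ)
  nlinarith [norm_nonneg ξ, Real.two_le_pi]

theorem isSymbol_clm (L : Rd d →L[ℝ] F) : IsSymbol 1 (fun ξ => L ξ) := by
  refine IsSymbol.of_fderiv (C := ‖L‖) L.differentiable ?_ fun ξ => ?_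
  · have e : (_root_.fderiv ℝ fun ξ => L ξ) = fun _ => L := by
      ext1 ξ
      exact L.fderiv
    rw [e, sub_self]
    exact isSymbol_const L
  · exact (L.le_opNorm ξ).trans
      (mul_le_mul_of_nonneg_left (norm_le_besselSymbol_one' ξ) (norm_nonneg _))

theorem besselSymbol_pow (s : ℝ) (i : ℕ) (ξ : Rd d) :
    besselSymbol d s ξ ^ i = besselSymbol d (s * i) ξ := by
  unfold besselSymbol
  rw [← Real.rpow_mul_natCast (by positivity)]
  congr 1
  ring

theorem besselSymbol_neg_one_pow (i : ℕ) (ξ : Rd d) :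
    besselSymbol d (-1) ξ ^ i = besselSymbol d (-i) ξ := by
  rw [besselSymbol_pow, neg_one_mul]

theorem IsSymbol.hasTemperateGrowth (h : IsSymbol t a) : a.HasTemperateGrowth := by
  refine ⟨h.1, fun n => ?_⟩
  obtain ⟨C, hC0, hC⟩ := h.exists_bound n
  obtain ⟨k, hk⟩ := exists_nat_ge (t - n)
  refine ⟨k, C * (2 * π) ^ k, fun ξ => (hC ξ).trans ?_⟩
  rw [mul_assoc, ← mul_pow]
  refine mul_le_mul_of_nonneg_left ?_ hC0
  calc besselSymbol d (t - n) ξ ≤ besselSymbol d k ξ := besselSymbol_mono hk ξ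
    _ = besselSymbol d 1 ξ ^ k := by rw [besselSymbol_pow, one_mul]
    _ ≤ _ := by
        refine pow_le_pow_left₀ (besselSymbol_pos 1 ξ).le ((besselSymbol_one_le ξ).trans ?_) k
        nlinarith [norm_nonneg ξ, Real.two_le_pi]

end Symbol

theorem isSymbol_besselSymbol_two : IsSymbol 2 (fun ξ : Rd d => besselSymbol d 2 ξ) := by
  have e : (fun ξ : Rd d => besselSymbol d 2 ξ) = fun ξ => 1 + (2 * π) ^ 2 * ‖ξ‖ ^ 2 := by
    ext ξ
    rw [besselSymbol_two, mul_pow]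
  have hdiff : ∀ ξ : Rd d, HasFDerivAt (fun ξ : Rd d => 1 + (2 * π) ^ 2 * ‖ξ‖ ^ 2)
      (((2 * π) ^ 2) • (2 • innerSL ℝ ξ)) ξ := fun ξ =>
    ((hasStrictFDerivAt_norm_sq ξ).hasFDerivAt.const_mul _).const_add _
  refine IsSymbol.of_fderiv (C := 1) ?_ ?_ fun ξ => ?_
  · rw [e]
    exact fun ξ => (hdiff ξ).differentiableAt
  · have e' : fderiv ℝ (fun ξ : Rd d => besselSymbol d 2 ξ) =
        fun ξ => (((2 * π) ^ 2) • (2 • innerSL ℝ (E := Rd d))) ξ := by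
      rw [e]
      ext1 ξ
      exact (hdiff ξ).fderiv
    rw [e', show (2 : ℝ) - 1 = 1 by norm_num]
    exact isSymbol_clm _
  · rw [Real.norm_of_nonneg (besselSymbol_pos 2 ξ).le, one_mul]

/-- Write ⟨y⟩^s = R^{s/2} (⟨y⟩²/R)^{s/2} with R = ⟨ξ⟩² frozen at the point where derivatives are
taken. The outer power is then differentiated only at 1, and the chain rule gives constants
independent of ξ. -/
theorem isSymbol_besselSymbol (s : ℝ) : IsSymbol s (fun ξ : Rd d => besselSymbol d s ξ) := by
  have hw := isSymbol_besselSymbol_two (d := d)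
  have hwpos : ∀ ξ : Rd d, 0 < besselSymbol d 2 ξ := besselSymbol_pos 2
  have e : (fun ξ : Rd d => besselSymbol d s ξ) = fun ξ => besselSymbol d 2 ξ ^ (s / 2) := by
    ext ξ
    rw [besselSymbol_two, besselSymbol]
  have hg : ContDiffOn ℝ ∞ (fun u : ℝ => u ^ (s / 2)) (Set.Ioi 0) := fun u hu =>
    (Real.contDiffAt_rpow_const_of_ne (ne_of_gt hu)).contDiffWithinAt
  refine ⟨?_, fun n => ?_⟩
  · rw [e]
    exact hg.comp_contDiff hw.1 fun ξ => hwpos ξ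
  obtain ⟨C, hC0, hC⟩ := hw.exists_uniform_bound n
  set D : ℝ := ∑ i ∈ Finset.range (n + 1),
    ‖iteratedFDerivWithin ℝ i (fun u : ℝ => u ^ (s / 2)) (Set.Ioi 0) 1‖ with hD
  -- The chain rule bound wants inner derivatives of order i below an i-th power; C ≤ (1 + C)^i for
  -- i ≥ 1 supplies it.
  refine ⟨n.factorial * D * (1 + C) ^ n, fun ξ => ?_⟩
  set R := besselSymbol d 2 ξ with hR
  have hR0 : 0 < R := hwpos ξ
  have e2 : (fun y : Rd d => besselSymbol d s y) = fun y => (R ^ (s / 2)) •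
      (((fun u : ℝ => u ^ (s / 2)) ∘ fun y : Rd d => R⁻¹ • besselSymbol d 2 y) y) := by
    rw [e]
    ext y
    simp only [Function.comp_apply, smul_eq_mul]
    rw [Real.mul_rpow (by positivity) (hwpos y).le, Real.inv_rpow hR0.le, ← mul_assoc,
      mul_inv_cancel₀ (Real.rpow_pos_of_pos hR0 _).ne', one_mul]
  have hfs : ContDiff ℝ ∞ (fun y : Rd d => R⁻¹ • besselSymbol d 2 y) := hw.1.const_smul R⁻¹
  have hpos : ∀ y : Rd d, R⁻¹ • besselSymbol d 2 y ∈ Set.Ioi (0 : ℝ) := fun y =>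
    mul_pos (inv_pos.2 hR0) (hwpos y)
  have key := norm_iteratedFDeriv_comp_le' (𝕜 := ℝ) (n := n) (C := D)
    (D := (1 + C) * besselSymbol d (-1) ξ) (t := Set.Ioi (0 : ℝ))
    (by rintro _ ⟨y, rfl⟩; exact hpos y) (uniqueDiffOn_Ioi 0) hg hfs (mod_cast le_top) ξ ?_ ?_
  · have hgf : ContDiff ℝ ∞ ((fun u : ℝ => u ^ (s / 2)) ∘
        fun y : Rd d => R⁻¹ • besselSymbol d 2 y) := hg.comp_contDiff hfs hpos
    rw [e2, iteratedFDeriv_const_smul_apply' ((hgf.of_le (mod_cast le_top)).contDiffAt),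
      norm_smul, Real.norm_of_nonneg (Real.rpow_nonneg hR0.le _)]
    refine (mul_le_mul_of_nonneg_left key (Real.rpow_nonneg hR0.le _)).trans (le_of_eq ?_)
    have : R ^ (s / 2) = besselSymbol d s ξ := (congr_fun e ξ).symm
    rw [this, mul_pow, besselSymbol_neg_one_pow, sub_eq_add_neg, ← besselSymbol_mul]
    ring
  · intro i hi
    have : R⁻¹ • besselSymbol d 2 ξ = 1 := inv_mul_cancel₀ hR0.ne'
    rw [this, hD]
    exact Finset.single_le_sum (f := fun i =>
      ‖iteratedFDerivWithin ℝ i (fun u : ℝ => u ^ (s / 2)) (Set.Ioi 0) 1‖)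
      (fun i _ => norm_nonneg _) (Finset.mem_range.2 (Nat.lt_succ_of_le hi))
  · intro i hi1 hi
    rw [iteratedFDeriv_const_smul_apply' ((hw.1.of_le (mod_cast le_top)).contDiffAt), norm_smul,
      Real.norm_of_nonneg (inv_nonneg.2 hR0.le)]
    refine (mul_le_mul_of_nonneg_left (hC i hi ξ) (inv_nonneg.2 hR0.le)).trans ?_
    rw [mul_pow, besselSymbol_neg_one_pow, sub_eq_add_neg, ← besselSymbol_mul, ← hR,
      mul_left_comm C, ← mul_assoc, inv_mul_cancel₀ hR0.ne', one_mul]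
    refine mul_le_mul_of_nonneg_right ?_ (besselSymbol_pos _ ξ).le
    calc C ≤ 1 + C := by linarith
      _ ≤ (1 + C) ^ i := le_self_pow₀ (by linarith) (by omega)

/-- In the chain rule every inner derivative of order i brings ⟨ξ⟩^{-i}, and these multiply to
⟨ξ⟩^{-n}. Derivatives of `f` matter only on the range of `q`. -/
theorem IsSymbol.comp {q : Rd d → ℝ} (hq : IsSymbol 0 q) {f : ℝ → ℝ} (hf : ContDiff ℝ ∞ f)
    (hb : ∀ i : ℕ, ∃ C : ℝ, ∀ ξ, ‖iteratedFDeriv ℝ i f (q ξ)‖ ≤ C) :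
    IsSymbol 0 (fun ξ => f (q ξ)) := by
  refine ⟨hf.comp hq.1, fun n => ?_⟩
  choose D hD using hb
  have hD0 : ∀ i, 0 ≤ D i := fun i => (norm_nonneg _).trans (hD i 0)
  obtain ⟨C, hC0, hC⟩ := hq.exists_uniform_bound n
  refine ⟨n.factorial * (∑ i ∈ Finset.range (n + 1), D i) * (1 + C) ^ n, fun ξ => ?_⟩
  have key := norm_iteratedFDeriv_comp_le (n := n) hf hq.1 (mod_cast le_top) ξ
    (C := ∑ i ∈ Finset.range (n + 1), D i) (D := (1 + C) * besselSymbol d (-1) ξ)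
    (fun i hi => (hD i ξ).trans (Finset.single_le_sum (fun i _ => hD0 i)
      (Finset.mem_range.2 (Nat.lt_succ_of_le hi)))) fun i hi1 hi => ?_
  · refine key.trans (le_of_eq ?_)
    rw [mul_pow, besselSymbol_neg_one_pow, zero_sub]
    ring
  · refine (hC i hi ξ).trans ?_
    rw [mul_pow, besselSymbol_neg_one_pow, zero_sub]
    refine mul_le_mul_of_nonneg_right ?_ (besselSymbol_pos _ ξ).le
    calc C ≤ 1 + C := by linarith
      _ ≤ (1 + C) ^ i := le_self_pow₀ (by linarith) (by omega)

theorem IsSymbol.ofReal {t : ℝ} {a : Rd d → ℝ} (h : IsSymbol t a) :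
    IsSymbol t (fun ξ => (a ξ : ℂ)) := by
  refine ⟨Complex.ofRealCLM.contDiff.comp h.1, fun k => ?_⟩
  obtain ⟨C, hC⟩ := h.2 k
  refine ⟨C, fun ξ => ?_⟩
  have hk : ContDiff ℝ k a := h.1.of_le (mod_cast le_top)
  have := Complex.ofRealLI.norm_iteratedFDeriv_comp_left (f := a) (x := ξ)
    hk.contDiffAt le_rfl
  exact this.le.trans (hC ξ)

/-- Peetre's inequality. -/
theorem besselSymbol_le_of_norm_sub_le (t : ℝ) {y ξ η : Rd d} (h : ‖y - ξ‖ ≤ ‖η‖) :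
    besselSymbol d t y ≤ 2 ^ (|t| / 2) * besselSymbol d t ξ * besselSymbol d |t| η := by
  have key : ∀ {s : ℝ} {y ξ : Rd d}, 0 ≤ s → ‖y - ξ‖ ≤ ‖η‖ →
      besselSymbol d s y ≤ 2 ^ (s / 2) * besselSymbol d s ξ * besselSymbol d s η := by
    intro s y ξ hs h
    unfold besselSymbol
    rw [← Real.mul_rpow (by norm_num) (by positivity),
      ← Real.mul_rpow (by positivity) (by positivity)]
    refine Real.rpow_le_rpow (by positivity) ?_ (by positivity)
    have h1 : ‖y‖ ≤ ‖ξ‖ + ‖η‖ := by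
      calc ‖y‖ = ‖ξ + (y - ξ)‖ := by congr 1; abel
        _ ≤ _ := (norm_add_le _ _).trans (by linarith)
    have h2 : 2 * π * ‖y‖ ≤ 2 * π * ‖ξ‖ + 2 * π * ‖η‖ := by
      rw [← mul_add]
      exact mul_le_mul_of_nonneg_left h1 (by positivity)
    have h3 : 0 ≤ 2 * π * ‖y‖ := by positivity
    have h4 := pow_le_pow_left₀ h3 h2 2
    nlinarith [sq_nonneg (2 * π * ‖ξ‖ - 2 * π * ‖η‖),
      mul_nonneg (sq_nonneg (2 * π * ‖ξ‖)) (sq_nonneg (2 * π * ‖η‖))]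
  rcases le_total 0 t with ht | ht
  · rw [abs_of_nonneg ht]
    exact key ht h
  · rw [abs_of_nonpos ht]
    -- A negative exponent follows from the positive one with the two points exchanged, then
    -- dividing.
    have h1 := key (neg_nonneg.2 ht) (y := ξ) (ξ := y) (by rwa [norm_sub_rev])
    have h2 : besselSymbol d t ξ * besselSymbol d (-t) ξ = 1 := by
      rw [besselSymbol_mul, add_neg_cancel, besselSymbol_zero]
    have h3 : besselSymbol d t y * besselSymbol d (-t) y = 1 := by
      rw [besselSymbol_mul, add_neg_cancel, besselSymbol_zero]
    calc besselSymbol d t y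
        = besselSymbol d t y * besselSymbol d t ξ * besselSymbol d (-t) ξ := by
          rw [mul_assoc, h2, mul_one]
      _ ≤ besselSymbol d t y * besselSymbol d t ξ *
          (2 ^ (-t / 2) * besselSymbol d (-t) y * besselSymbol d (-t) η) :=
          mul_le_mul_of_nonneg_left h1
            (mul_nonneg (besselSymbol_pos t y).le (besselSymbol_pos t ξ).le)
      _ = (besselSymbol d t y * besselSymbol d (-t) y) *
          (2 ^ (-t / 2) * besselSymbol d t ξ * besselSymbol d (-t) η) := by ring
      _ = _ := by rw [h3, one_mul]

/-! ### Differences averaged against a rapidly decaying kernel -/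

/-- A continuous kernel all of whose moments are integrable. -/
structure DecayKernel (k : Rd d → ℝ) : Prop where
  continuous : Continuous k
  integrable : ∀ s : ℝ, Integrable fun η => |k η| * besselSymbol d s η

/-- The average `∫ k(η) (a(ξ) - a(ξ - η)) dη`. -/
def convDiff {F : Type*} [NormedAddCommGroup F] [NormedSpace ℝ F] (k : Rd d → ℝ) (a : Rd d → F)
    (ξ : Rd d) : F := ∫ η, k η • (a ξ - a (ξ - η))

section ConvDiff

variable {F : Type*} [NormedAddCommGroup F] [NormedSpace ℝ F] {t : ℝ} {a : Rd d → F}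
  {k : Rd d → ℝ}

/-- Mean value inequality on the ball of radius ‖η‖ about ξ. Peetre's inequality carries the weight
from the intermediate point back to ξ, and the length ‖η‖ costs one more power of ⟨η⟩. -/
theorem norm_sub_le_of_norm_fderiv_le (ha : Differentiable ℝ a) {C : ℝ}
    (hC : ∀ ξ, ‖fderiv ℝ a ξ‖ ≤ C * besselSymbol d t ξ) (ξ η : Rd d) :
    ‖a ξ - a (ξ - η)‖ ≤
      C * 2 ^ (|t| / 2) * besselSymbol d t ξ * besselSymbol d (|t| + 1) η := by
  have hC0 : 0 ≤ C := nonneg_of_norm_le_mul_besselSymbol (hC 0)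
  have hb : ∀ y ∈ Metric.closedBall ξ ‖η‖, ‖fderiv ℝ a y‖ ≤
      C * (2 ^ (|t| / 2) * besselSymbol d t ξ * besselSymbol d |t| η) := fun y hy =>
    (hC y).trans (mul_le_mul_of_nonneg_left
      (besselSymbol_le_of_norm_sub_le t (by simpa [dist_eq_norm] using hy)) hC0)
  have h := (convex_closedBall ξ ‖η‖).norm_image_sub_le_of_norm_fderiv_le
    (fun y _ => ha y) hb (x := ξ - η) (y := ξ) (by simp) (by simp)
  refine h.trans ?_
  rw [sub_sub_cancel]
  have h1 := norm_le_besselSymbol_one' η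
  have h2 := (besselSymbol_pos t ξ).le
  have h3 := (besselSymbol_pos |t| η).le
  rw [← besselSymbol_mul]
  calc _ ≤ C * (2 ^ (|t| / 2) * besselSymbol d t ξ * besselSymbol d |t| η) *
        besselSymbol d 1 η := by gcongr
    _ = _ := by ring

theorem norm_convDiff_integrand_le (ha : Differentiable ℝ a) {C : ℝ}
    (hC : ∀ ξ, ‖fderiv ℝ a ξ‖ ≤ C * besselSymbol d t ξ) (ξ η : Rd d) :
    ‖k η • (a ξ - a (ξ - η))‖ ≤
      C * 2 ^ (|t| / 2) * besselSymbol d t ξ * (|k η| * besselSymbol d (|t| + 1) η) := by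
  rw [norm_smul, Real.norm_eq_abs, mul_left_comm]
  exact mul_le_mul_of_nonneg_left (norm_sub_le_of_norm_fderiv_le ha hC ξ η) (abs_nonneg _)

theorem aestronglyMeasurable_convDiff_integrand (hk : DecayKernel k) (ha : Continuous a)
    (ξ : Rd d) : AEStronglyMeasurable (fun η => k η • (a ξ - a (ξ - η))) := by
  have := hk.continuous
  exact Continuous.aestronglyMeasurable (by fun_prop)

theorem integrable_convDiff_integrand (hk : DecayKernel k) (ha : Differentiable ℝ a) {C : ℝ}
    (hC : ∀ ξ, ‖fderiv ℝ a ξ‖ ≤ C * besselSymbol d t ξ) (ξ : Rd d) :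
    Integrable fun η => k η • (a ξ - a (ξ - η)) :=
  Integrable.mono' ((hk.integrable _).const_mul _)
    (aestronglyMeasurable_convDiff_integrand hk ha.continuous ξ)
    (Filter.Eventually.of_forall fun η => norm_convDiff_integrand_le ha hC ξ η)

theorem norm_convDiff_le (hk : DecayKernel k) (ha : Differentiable ℝ a) {C : ℝ}
    (hC : ∀ ξ, ‖fderiv ℝ a ξ‖ ≤ C * besselSymbol d t ξ) :
    ∃ C' : ℝ, ∀ ξ, ‖convDiff k a ξ‖ ≤ C' * besselSymbol d t ξ := by
  refine ⟨C * 2 ^ (|t| / 2) * ∫ η, |k η| * besselSymbol d (|t| + 1) η, fun ξ => ?_⟩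
  refine (norm_integral_le_of_norm_le ((hk.integrable _).const_mul _)
    (Filter.Eventually.of_forall fun η => norm_convDiff_integrand_le ha hC ξ η)).trans ?_
  rw [integral_const_mul]
  exact le_of_eq (by ring)

/-- Differentiation under the integral. The dominating function needs no cancellation: the triangle
inequality, Peetre's inequality, and the bound `M` of the weight on the unit ball about ξ suffice.
-/
theorem hasFDerivAt_convDiff (hk : DecayKernel k) (ha : ContDiff ℝ 1 a) {C : ℝ}
    (hC : ∀ ξ, ‖fderiv ℝ a ξ‖ ≤ C * besselSymbol d t ξ) (ξ : Rd d) :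
    HasFDerivAt (convDiff k a) (convDiff k (fderiv ℝ a) ξ) ξ := by
  have hC0 : 0 ≤ C := nonneg_of_norm_le_mul_besselSymbol (hC 0)
  have hd : Differentiable ℝ a := ha.differentiable one_ne_zero
  have hf : Continuous (fderiv ℝ a) := ha.continuous_fderiv one_ne_zero
  obtain ⟨M, hM⟩ := (isCompact_closedBall ξ 1).exists_bound_of_continuousOn
    (continuous_besselSymbol (d := d) t).continuousOn
  have hM' : ∀ x ∈ Metric.ball ξ 1, besselSymbol d t x ≤ M := fun x hx =>
    (le_abs_self _).trans (hM x (Metric.ball_subset_closedBall hx))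
  refine hasFDerivAt_integral_of_dominated_of_fderiv_le (𝕜 := ℝ)
    (bound := fun η => |k η| * besselSymbol d |t| η * (C * M * (1 + 2 ^ (|t| / 2))))
    (F' := fun x η => k η • (fderiv ℝ a x - fderiv ℝ a (x - η)))
    (Metric.ball_mem_nhds ξ one_pos)
    (Filter.Eventually.of_forall fun x =>
      aestronglyMeasurable_convDiff_integrand hk ha.continuous x)
    (integrable_convDiff_integrand hk hd hC ξ)
    (aestronglyMeasurable_convDiff_integrand hk hf ξ)
    (Filter.Eventually.of_forall fun η x hx => ?_)
    ((hk.integrable _).mul_const _)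
    (Filter.Eventually.of_forall fun η x hx => ?_)
  · rw [norm_smul, Real.norm_eq_abs, mul_assoc]
    refine mul_le_mul_of_nonneg_left ?_ (abs_nonneg _)
    have h1 := hM' x hx
    have h0 := (besselSymbol_pos t x).le
    have h2 := one_le_besselSymbol (abs_nonneg t) η
    have h3 : besselSymbol d t (x - η) ≤
        2 ^ (|t| / 2) * besselSymbol d t x * besselSymbol d |t| η :=
      besselSymbol_le_of_norm_sub_le t (by simp)
    calc ‖fderiv ℝ a x - fderiv ℝ a (x - η)‖
        ≤ C * besselSymbol d t x + C * besselSymbol d t (x - η) :=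
          (norm_sub_le _ _).trans (add_le_add (hC x) (hC _))
      _ ≤ C * (M * besselSymbol d |t| η) + C * (2 ^ (|t| / 2) * M * besselSymbol d |t| η) := by
          have hM0 : 0 ≤ M := h0.trans h1
          gcongr
          · nlinarith
          · refine h3.trans ?_
            gcongr
      _ = _ := by ring
  · have h1 : HasFDerivAt a (fderiv ℝ a x) x := (hd x).hasFDerivAt
    have h2 : HasFDerivAt (fun y => a (y - η)) (fderiv ℝ a (x - η)) x :=
      (hasFDerivAt_comp_sub η).2 (hd (x - η)).hasFDerivAt
    exact (h1.sub h2).const_smul (k η)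

end ConvDiff

/-- Averaged differences commute with `fderiv`, so only n = 0 needs an estimate, and there the
gradient bound of order t - 1 is the gain. The target space varies because each derivative changes
it. -/
theorem IsSymbol.convDiff_aux {k : Rd d → ℝ} (hk : DecayKernel k) (n : ℕ) :
    ∀ {F : Type} [NormedAddCommGroup F] [NormedSpace ℝ F] {t : ℝ} {a : Rd d → F},
      IsSymbol t a → ContDiff ℝ n (convDiff k a) ∧ ∃ C : ℝ, ∀ ξ,
        ‖iteratedFDeriv ℝ n (convDiff k a) ξ‖ ≤ C * besselSymbol d (t - 1 - n) ξ := by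
  induction n with
  | zero =>
    intro F _ _ t a h
    obtain ⟨C, hC0, hC⟩ := h.fderiv.exists_norm_le
    refine ⟨?_, ?_⟩
    · exact contDiff_zero.2 (continuous_iff_continuousAt.2 fun ξ =>
        (hasFDerivAt_convDiff hk (h.1.of_le (mod_cast le_top)) hC ξ).continuousAt)
    · obtain ⟨C', hC'⟩ := norm_convDiff_le hk (h.1.differentiable (by simp)) hC
      exact ⟨C', fun ξ => by simpa using hC' ξ⟩
  | succ n ih =>
    intro F _ _ t a h
    obtain ⟨C, hC0, hC⟩ := h.fderiv.exists_norm_le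
    have hd := hasFDerivAt_convDiff hk (h.1.of_le (mod_cast le_top)) hC
    have e : _root_.fderiv ℝ (FracLoc.convDiff k a) = FracLoc.convDiff k (_root_.fderiv ℝ a) := funext fun ξ => (hd ξ).fderiv
    obtain ⟨h1, C', hC'⟩ := ih h.fderiv
    refine ⟨?_, C', fun ξ => ?_⟩
    · rw [Nat.cast_add_one]
      refine contDiff_succ_iff_fderiv.2 ⟨fun ξ => (hd ξ).differentiableAt, by simp, ?_⟩
      rwa [e]
    · rw [← norm_iteratedFDeriv_fderiv, e]
      convert hC' ξ using 3
      push_cast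
      ring

theorem IsSymbol.convDiff {k : Rd d → ℝ} (hk : DecayKernel k) {F : Type} [NormedAddCommGroup F]
    [NormedSpace ℝ F] {t : ℝ} {a : Rd d → F} (h : IsSymbol t a) :
    IsSymbol (t - 1) (convDiff k a) :=
  ⟨contDiff_infty.2 fun n => (IsSymbol.convDiff_aux hk n h).1,
    fun n => (IsSymbol.convDiff_aux hk n h).2⟩

/-! ### Fourier multipliers away from the diagonal -/

theorem fourier_comp_add (f : Rd d → ℂ) (w y : Rd d) :
    𝓕 (fun v => f (v + w)) y = 𝐞 (inner ℝ w y) • 𝓕 f y := by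
  rw [Real.fourier_eq, Real.fourier_eq, Circle.smul_def, ← integral_smul,
    ← integral_add_right_eq_self (fun v => (𝐞 (inner ℝ w y) : ℂ) • 𝐞 (-inner ℝ v y) • f v) w]
  congr 1
  ext v
  rw [← Circle.smul_def, smul_smul, ← AddChar.map_add_eq_mul, inner_add_left]
  congr 2
  ring

/-- The translate `y ↦ φ (y + x)`. -/
def translate (x : Rd d) (φ : 𝓢(Rd d, ℂ)) : 𝓢(Rd d, ℂ) := SchwartzMap.compSubConstCLM ℂ (-x) φ

theorem translate_apply (x : Rd d) (φ : 𝓢(Rd d, ℂ)) (y : Rd d) : translate x φ y = φ (y + x) := by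
  rw [translate, SchwartzMap.compSubConstCLM_apply, sub_neg_eq_add]

theorem fourier_translate (x : Rd d) (φ : 𝓢(Rd d, ℂ)) (y : Rd d) :
    𝓕 (translate x φ) y = 𝐞 (inner ℝ x y) • 𝓕 φ y := by
  have e : (translate x φ : Rd d → ℂ) = fun v => φ (v + x) := funext (translate_apply x φ)
  rw [SchwartzMap.fourier_coe, SchwartzMap.fourier_coe, e, fourier_comp_add]

theorem fourierInv_translate (x : Rd d) (φ : 𝓢(Rd d, ℂ)) (y : Rd d) :
    𝓕⁻ (translate x φ) y = 𝐞 (-inner ℝ x y) • 𝓕⁻ φ y := by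
  have h := fourier_translate x φ (-y)
  rw [SchwartzMap.fourier_coe, SchwartzMap.fourier_coe, ← Real.fourierInv_eq_fourier_neg,
    ← Real.fourierInv_eq_fourier_neg, inner_neg_right] at h
  rwa [SchwartzMap.fourierInv_coe, SchwartzMap.fourierInv_coe]

/-- The phase of the Fourier integral at `x` is absorbed into a translation, so that support
conditions around `x` become conditions around the origin. -/
theorem mulF_apply_eq_integral {g : Rd d → ℂ} (hg : g.HasTemperateGrowth) (φ : 𝓢(Rd d, ℂ))
    (x : Rd d) : mulF g φ x = ∫ ξ, g ξ * 𝓕⁻ (translate x φ) ξ := by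
  rw [mulF_apply, SchwartzMap.fourier_coe, Real.fourier_eq]
  congr 1
  ext ξ
  rw [smulS_apply hg, fourierInv_translate, real_inner_comm, Circle.smul_def, Circle.smul_def,
    smul_eq_mul, smul_eq_mul, mul_left_comm]

theorem integrable_besselSymbol : Integrable fun ξ : Rd d => besselSymbol d (-(d + 1)) ξ := by
  have h := integrable_rpow_neg_one_add_norm_sq (E := Rd d) (μ := volume) (r := d + 1)
    (by simp)
  refine Integrable.mono' h (continuous_besselSymbol _).aestronglyMeasurable
    (Filter.Eventually.of_forall fun ξ => ?_)
  rw [Real.norm_of_nonneg (besselSymbol_pos _ ξ).le, besselSymbol]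
  refine Real.rpow_le_rpow_of_nonpos (by positivity) ?_ (by
    have : (0 : ℝ) ≤ d := d.cast_nonneg
    linarith)
  have : ‖ξ‖ ≤ 2 * π * ‖ξ‖ := by nlinarith [norm_nonneg ξ, Real.two_le_pi]
  have := norm_nonneg ξ
  gcongr

theorem exists_norm_le_besselSymbol (ψ : 𝓢(Rd d, ℂ)) (s : ℝ) :
    ∃ C : ℝ, 0 ≤ C ∧ ∀ ξ, ‖ψ ξ‖ ≤ C * besselSymbol d s ξ := by
  refine ⟨SchwartzMap.seminorm ℝ 0 0 (smulS (fun ξ => (besselSymbol d (-s) ξ : ℂ)) ψ),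
    apply_nonneg _ _, fun ξ => ?_⟩
  have h := SchwartzMap.norm_le_seminorm ℝ (smulS (fun ξ => (besselSymbol d (-s) ξ : ℂ)) ψ) ξ
  rw [norm_smulS_besselSymbol] at h
  calc ‖ψ ξ‖ = besselSymbol d (-s) ξ * ‖ψ ξ‖ * besselSymbol d s ξ := by
        rw [mul_right_comm, besselSymbol_mul, neg_add_cancel, besselSymbol_zero, one_mul]
    _ ≤ _ := mul_le_mul_of_nonneg_right h (besselSymbol_pos s ξ).le

theorem integrable_norm_mul_besselSymbol (ψ : 𝓢(Rd d, ℂ)) (s : ℝ) :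
    Integrable fun ξ => ‖ψ ξ‖ * besselSymbol d s ξ := by
  refine ((smulS (fun ξ => (besselSymbol d s ξ : ℂ)) ψ).integrable (μ := volume)).norm.congr
    (Filter.Eventually.of_forall fun ξ => ?_)
  simp only
  rw [norm_smulS_besselSymbol, mul_comm]

theorem besselSymbol_neg_arg (s : ℝ) (ξ : Rd d) : besselSymbol d s (-ξ) = besselSymbol d s ξ := by
  simp [besselSymbol]

section OffDiagonal

variable {χ : 𝓢(Rd d, ℂ)} {k : Rd d → ℝ}

theorem decayKernel_of_fourier (hk : ∀ η, (k η : ℂ) = 𝓕 χ η) : DecayKernel k := by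
  have e : k = fun η => (𝓕 χ η).re := by
    ext η
    rw [← hk η, Complex.ofReal_re]
  refine ⟨?_, fun s => ?_⟩
  · rw [e]
    exact Complex.continuous_re.comp (𝓕 χ).continuous
  · refine (integrable_norm_mul_besselSymbol (𝓕 χ) s).congr
      (Filter.Eventually.of_forall fun η => ?_)
    simp only
    rw [← hk η, Complex.norm_real, Real.norm_eq_abs]

theorem integral_fourier_kernel (hχ : χ 0 = 1) (hk : ∀ η, (k η : ℂ) = 𝓕 χ η) :
    ∫ η, (k η : ℂ) = 1 := by
  have h : 𝓕⁻ (𝓕 χ) 0 = χ 0 := by rw [fourierInv_fourier_eq]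
  rw [SchwartzMap.fourierInv_coe, Real.fourierInv_eq, hχ] at h
  rw [← h]
  congr 1
  ext η
  simp [hk]

/-- Moving the Fourier transform from χ to the other factor turns the integrand into χ(y) φ(y + x)
times a phase, which vanishes identically. -/
theorem integral_kernel_mul_translate (hk : ∀ η, (k η : ℂ) = 𝓕 χ η) {φ : 𝓢(Rd d, ℂ)}
    {x : Rd d} (h0 : ∀ y, χ y * φ (y + x) = 0) (ζ : Rd d) :
    ∫ ξ, (k (ξ - ζ) : ℂ) * 𝓕⁻ (translate x φ) ξ = 0 := by
  rw [← integral_add_right_eq_self _ ζ]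
  simp_rw [add_sub_cancel_right, hk, ← translate_apply ζ]
  rw [SchwartzMap.integral_fourier_mul_eq]
  refine integral_eq_zero_of_ae (Filter.Eventually.of_forall fun y => ?_)
  simp only [Pi.zero_apply]
  rw [fourier_translate, fourier_fourierInv_eq, translate_apply, Circle.smul_def, smul_eq_mul,
    mul_left_comm, h0, mul_zero]

/-- The two symbols differ by k * a, since ∫ k = 1. By Fubini the value at `x` of the multiplier k *
a is an integral over ζ whose inner integral is zero by `integral_kernel_mul_translate`. -/
theorem mulF_convDiff_apply (hχ : χ 0 = 1) (hk : ∀ η, (k η : ℂ) = 𝓕 χ η) {t : ℝ}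
    {a : Rd d → ℂ} (ha : IsSymbol t a) {φ : 𝓢(Rd d, ℂ)} {x : Rd d}
    (h0 : ∀ y, χ y * φ (y + x) = 0) : mulF (convDiff k a) φ x = mulF a φ x := by
  have hK := decayKernel_of_fourier hk
  have hT := ha.convDiff hK
  set h := 𝓕⁻ (translate x φ) with hh
  have hint : ∀ {s : ℝ} {b : Rd d → ℂ}, IsSymbol s b → Integrable fun ξ => b ξ * h ξ := by
    intro s b hb
    refine ((smulS b h).integrable (μ := volume)).congr (Filter.Eventually.of_forall fun ξ => ?_)
    exact smulS_apply hb.hasTemperateGrowth h ξ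
  have hconv : ∀ ξ, a ξ - convDiff k a ξ = ∫ ζ, (k (ξ - ζ) : ℂ) * a ζ := by
    intro ξ
    obtain ⟨C, -, hC⟩ := ha.fderiv.exists_norm_le
    have i1 := integrable_convDiff_integrand hK (ha.1.differentiable (by simp)) hC ξ
    have i2 : Integrable fun η => (k η : ℂ) * a ξ := by
      refine Integrable.mul_const ?_ _
      simp_rw [hk]
      exact (𝓕 χ).integrable
    have i3 := integral_sub i2 i1
    rw [integral_mul_const, integral_fourier_kernel hχ hk, one_mul] at i3
    rw [convDiff, ← i3, ← integral_sub_left_eq_self _ volume ξ]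
    congr 1
    ext ζ
    simp only [Complex.real_smul, sub_sub_cancel]
    ring
  rw [mulF_apply_eq_integral hT.hasTemperateGrowth, mulF_apply_eq_integral ha.hasTemperateGrowth,
    ← hh, ← sub_eq_zero, ← neg_eq_zero, neg_sub, ← integral_sub (hint ha) (hint hT)]
  simp_rw [← sub_mul, hconv, ← integral_mul_const]
  obtain ⟨A, hA0, hA⟩ := ha.exists_norm_le
  -- This decay beats the growth ⟨ζ⟩^t of `a` and leaves the integrable weight ⟨ζ⟩^{-(d+1)};
  -- Peetre's inequality puts the loss on the Schwartz factor in ξ.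
  obtain ⟨B, hB0, hB⟩ := exists_norm_le_besselSymbol (𝓕 χ) (-(t + (d + 1)))
  rw [integral_integral_swap]
  · refine integral_eq_zero_of_ae (Filter.Eventually.of_forall fun ζ => ?_)
    simp only [Pi.zero_apply]
    simp_rw [mul_right_comm _ (a ζ)]
    rw [integral_mul_const, integral_kernel_mul_translate hk h0, zero_mul]
  · have hm := Integrable.mul_prod (integrable_norm_mul_besselSymbol h |-(t + (d + 1))|)
      ((integrable_besselSymbol (d := d)).const_mul (B * 2 ^ (|-(t + (d + 1))| / 2) * A))
    refine Integrable.mono' hm ?_ (Filter.Eventually.of_forall fun p => ?_)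
    · have h1 := hK.continuous
      have h2 := ha.1.continuous
      have h3 := h.continuous
      refine Continuous.aestronglyMeasurable ?_
      unfold Function.uncurry
      fun_prop
    · obtain ⟨ξ, ζ⟩ := p
      simp only [Function.uncurry]
      have h1 := hA ζ
      have h2 := hB (ξ - ζ)
      have h3 := besselSymbol_le_of_norm_sub_le (-(t + (d + 1))) (y := ξ - ζ) (ξ := -ζ) (η := ξ)
        (by simp)
      rw [besselSymbol_neg_arg] at h3
      have h4 : besselSymbol d (-(t + (d + 1))) ζ * besselSymbol d t ζ =
          besselSymbol d (-(d + 1)) ζ := by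
        rw [besselSymbol_mul]
        congr 1
        ring
      rw [norm_mul, norm_mul, hk, ← h4]
      have h5 := h2.trans (mul_le_mul_of_nonneg_left h3 hB0)
      have h6 := (norm_nonneg _).trans h5
      calc ‖𝓕 χ (ξ - ζ)‖ * ‖a ζ‖ * ‖h ξ‖
          ≤ (B * (2 ^ (|-(t + (d + 1))| / 2) * besselSymbol d (-(t + (d + 1))) ζ *
              besselSymbol d |-(t + (d + 1))| ξ)) * (A * besselSymbol d t ζ) * ‖h ξ‖ := by
            gcongr
        _ = _ := by ring

end OffDiagonal

/-- There is a kernel with compactly supported Fourier transform. -/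
theorem exists_kernel {δ : ℝ} (hδ : 0 < δ) : ∃ (χ : 𝓢(Rd d, ℂ)) (k : Rd d → ℝ),
    χ 0 = 1 ∧ (∀ y, δ ≤ ‖y‖ → χ y = 0) ∧ ∀ η, (k η : ℂ) = 𝓕 χ η := by
  let b : ContDiffBump (0 : Rd d) := ⟨δ / 2, δ, by linarith, by linarith⟩
  have c1 : HasCompactSupport (Complex.ofRealCLM ∘ b) := b.hasCompactSupport.comp_left rfl
  have c2 : ContDiff ℝ ∞ (Complex.ofRealCLM ∘ b) :=
    Complex.ofRealCLM.contDiff.comp b.contDiff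
  let χ : 𝓢(Rd d, ℂ) := c1.toSchwartzMap c2
  have hχ : ∀ y, χ y = (b y : ℂ) := fun y => rfl
  refine ⟨χ, fun η => (𝓕 χ η).re, ?_, fun y hy => ?_, fun η => ?_⟩
  · rw [hχ, b.one_of_mem_closedBall (Metric.mem_closedBall_self b.rIn_pos.le)]
    simp
  · rw [hχ, b.zero_of_le_dist (by simpa [b] using hy)]
    simp
  -- The bump is real and even, so its Fourier transform is real.
  · refine Complex.conj_eq_iff_re.1 ?_
    rw [SchwartzMap.fourier_coe, Real.fourier_eq, ← integral_conj,
      ← integral_neg_eq_self]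
    congr 1
    ext y
    have e : ((starRingEnd ℂ) (𝐞 (-inner ℝ (-y) η) : ℂ)) = 𝐞 (-inner ℝ y η) := by
      rw [Circle.starRingEnd_addChar, inner_neg_left, neg_neg]
    rw [Circle.smul_def, Circle.smul_def, smul_eq_mul, smul_eq_mul, map_mul, e, hχ, hχ, b.neg,
      Complex.conj_ofReal]

/-- Away from the support of `φ`, a Fourier multiplier may be replaced by one of arbitrarily
low order. -/
theorem exists_symbol_eq_off_support {δ : ℝ} (hδ : 0 < δ) {t : ℝ} {a : Rd d → ℂ}
    (ha : IsSymbol t a) (n : ℕ) : ∃ b : Rd d → ℂ, IsSymbol (t - n) b ∧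
      ∀ (φ : 𝓢(Rd d, ℂ)) (x : Rd d), (∀ y, dist x y < δ → φ y = 0) →
        mulF b φ x = mulF a φ x := by
  obtain ⟨χ, k, h1, hχ, hk⟩ := exists_kernel (d := d) hδ
  induction n with
  | zero => exact ⟨a, by simpa using ha, fun _ _ _ => rfl⟩
  | succ n ih =>
    obtain ⟨b, hb, hab⟩ := ih
    -- Each averaging lowers the order by one and leaves the values at such points unchanged, so the
    -- same kernel serves at every stage.
    refine ⟨convDiff k b, ?_, fun φ x h => ?_⟩
    · rw [Nat.cast_add_one, ← sub_sub]
      exact hb.convDiff (decayKernel_of_fourier hk)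
    · rw [mulF_convDiff_apply h1 hk hb fun y => ?_, hab φ x h]
      rcases lt_or_ge ‖y‖ δ with hy | hy
      · rw [h (y + x) (by simpa [dist_eq_norm] using hy), mul_zero]
      · rw [hχ y hy, zero_mul]

/-! ### Localized estimates for Fourier multipliers -/

theorem IsSymbol.exists_sNorm_mulF_le {t : ℝ} {a : Rd d → ℂ} (ha : IsSymbol t a) :
    ∃ C : ℝ, 0 ≤ C ∧ ∀ φ : 𝓢(Rd d, ℂ), sNorm (mulF a φ) ≤ C * sNorm (sJ t φ) := by
  obtain ⟨C, hC0, hC⟩ := ha.exists_norm_le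
  refine ⟨C, hC0, sNorm_mulF_le ha.hasTemperateGrowth (besselSymbol_hasTemperateGrowth t)
    fun ξ => ?_⟩
  rw [norm_ofReal_besselSymbol]
  exact hC ξ

theorem sJ_mulF_comm (s : ℝ) {g : Rd d → ℂ} (hg : g.HasTemperateGrowth) (φ : 𝓢(Rd d, ℂ)) :
    sJ s (mulF g φ) = mulF g (sJ s φ) := by
  rw [sJ, mulF_mulF (besselSymbol_hasTemperateGrowth s) hg,
    mulF_mulF hg (besselSymbol_hasTemperateGrowth s)]
  simp_rw [mul_comm]

theorem smulR_add_smulR_one_sub {θ : Rd d → ℝ} (hθ : BddSmooth θ) (φ : 𝓢(Rd d, ℂ)) :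
    smulR θ φ + smulR (fun x => 1 - θ x) φ = φ := by
  ext x
  rw [add_apply, smulS_apply hθ.hasTemperateGrowth, smulS_apply hθ.one_sub.hasTemperateGrowth]
  push_cast
  ring

/-- Split the test function by 1 = θ₁ + (1 - θ₁): the θ₁ part meets the local bound `A`; in the
other part `a` is replaced by a symbol of low order, so the weak bound `W` is enough. -/
theorem exists_localized_bound {θ₁ θ₂ : Rd d → ℝ} (h₁ : BddSmooth θ₁) (h₂ : BddSmooth θ₂)
    {δ : ℝ} (hδ : 0 < δ) (hsep : ∀ x, θ₁ x ≠ 1 → ∀ y, θ₂ y ≠ 0 → δ ≤ dist x y)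
    {t : ℝ} {a : Rd d → ℂ} (ha : IsSymbol t a) (K : ℝ) :
    ∃ C : ℝ, 0 ≤ C ∧ ∀ (g : TD d) (A W : ℝ), 0 ≤ A → 0 ≤ W →
      (∀ ψ, ‖g (smulR θ₁ ψ)‖ ≤ A * sNorm ψ) → (∀ ψ, ‖g ψ‖ ≤ W * sNorm (sJ K ψ)) →
      ∀ φ, ‖g (mulF a (smulR θ₂ φ))‖ ≤ C * (A + W) * sNorm (sJ t φ) := by
  -- Lowering the order by n ≥ K makes the total order t - n + K at most t.
  obtain ⟨n, hn⟩ := exists_nat_ge K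
  obtain ⟨b, hb, hab⟩ := exists_symbol_eq_off_support hδ ha n
  obtain ⟨Ca, hCa0, hCa⟩ := ha.exists_sNorm_mulF_le
  obtain ⟨Cb, hCb0, hCb⟩ := hb.exists_sNorm_mulF_le
  obtain ⟨C₁, hC₁0, hC₁⟩ := h₁.one_sub.sobolevBounded K
  obtain ⟨C₂, hC₂0, hC₂⟩ := h₂.sobolevBounded t
  refine ⟨Ca * C₂ + C₁ * Cb * C₂, by positivity, fun g A W hA hW hgA hgW φ => ?_⟩
  have e : smulR (fun x => 1 - θ₁ x) (mulF a (smulR θ₂ φ)) =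
      smulR (fun x => 1 - θ₁ x) (mulF b (smulR θ₂ φ)) := by
    ext x
    rw [smulS_apply h₁.one_sub.hasTemperateGrowth, smulS_apply h₁.one_sub.hasTemperateGrowth]
    by_cases hx : θ₁ x = 1
    · simp [hx]
    · rw [hab]
      intro y hy
      have : θ₂ y = 0 := by
        by_contra h
        exact absurd (hsep x hx y h) (not_le.2 hy)
      rw [smulS_apply h₂.hasTemperateGrowth, this]
      simp
  have hN := sNorm_nonneg (sJ t φ)
  have b1 : ‖g (smulR θ₁ (mulF a (smulR θ₂ φ)))‖ ≤ A * (Ca * (C₂ * sNorm (sJ t φ))) :=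
    (hgA _).trans (mul_le_mul_of_nonneg_left
      ((hCa _).trans (mul_le_mul_of_nonneg_left (hC₂ φ) hCa0)) hA)
  have b2 : sNorm (sJ K (mulF b (smulR θ₂ φ))) ≤ Cb * (C₂ * sNorm (sJ t φ)) := by
    rw [sJ_mulF_comm _ hb.hasTemperateGrowth]
    refine (hCb _).trans (mul_le_mul_of_nonneg_left ?_ hCb0)
    rw [sJ_sJ]
    exact (sNorm_sJ_mono (by linarith) _).trans (hC₂ φ)
  have b3 : ‖g (smulR (fun x => 1 - θ₁ x) (mulF a (smulR θ₂ φ)))‖ ≤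
      W * (C₁ * (Cb * (C₂ * sNorm (sJ t φ)))) := by
    rw [e]
    exact (hgW _).trans (mul_le_mul_of_nonneg_left
      ((hC₁ _).trans (mul_le_mul_of_nonneg_left b2 hC₁0)) hW)
  rw [← smulR_add_smulR_one_sub h₁ (mulF a (smulR θ₂ φ)), map_add]
  refine (norm_add_le _ _).trans ((add_le_add b1 b3).trans ?_)
  have p1 : 0 ≤ W * (Ca * (C₂ * sNorm (sJ t φ))) := by positivity
  have p2 : 0 ≤ A * (C₁ * (Cb * (C₂ * sNorm (sJ t φ)))) := by positivity
  nlinarith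

/-! ### Elements of Sobolev spaces of negative order on the Fourier side -/

theorem RepresentedBy.apply_mulF {f : TD d} {h : Rd d → ℂ} (hf : RepresentedBy (𝓕 f) h)
    {g : Rd d → ℂ} (hg : g.HasTemperateGrowth) (φ : 𝓢(Rd d, ℂ)) :
    Integrable (fun ξ => 𝓕⁻ φ ξ * (g ξ * h ξ)) ∧
      f (mulF g φ) = ∫ ξ, 𝓕⁻ φ ξ * (g ξ * h ξ) := by
  have e : (fun ξ => smulS g (𝓕⁻ φ) ξ * h ξ) = fun ξ => 𝓕⁻ φ ξ * (g ξ * h ξ) := by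
    ext ξ
    rw [smulS_apply hg]
    ring
  have := hf (smulS g (𝓕⁻ φ))
  rw [e] at this
  exact this

theorem RepresentedBy.apply_eq {f : TD d} {h : Rd d → ℂ} (hf : RepresentedBy (𝓕 f) h)
    (φ : 𝓢(Rd d, ℂ)) :
    Integrable (fun ξ => 𝓕⁻ φ ξ * h ξ) ∧ f φ = ∫ ξ, 𝓕⁻ φ ξ * h ξ := by
  have := hf (𝓕⁻ φ)
  rwa [TemperedDistribution.fourier_apply, fourier_fourierInv_eq] at this

/-- The norm of `J^s f` controls the pairings of `𝓕 f` with weighted functions. -/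
theorem norm_integral_symbol_le {f : TD d} {s : ℝ} {u : Lp ℂ 2 (volume : Measure (Rd d))}
    (hu : besselJ s f = (u : TD d)) {h : Rd d → ℂ} (hf : RepresentedBy (𝓕 f) h)
    {σ : Rd d → ℂ} {C r : ℝ} (hσ : ∀ ξ, ‖σ ξ‖ ≤ C * besselSymbol d r ξ) (φ : 𝓢(Rd d, ℂ)) :
    ‖∫ ξ, 𝓕⁻ φ ξ * (σ ξ * h ξ)‖ ≤ C * ‖u‖ * sNorm (sJ (r - s) φ) := by
  have hC0 : 0 ≤ C := nonneg_of_norm_le_mul_besselSymbol (hσ 0)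
  have h1 : RepresentedBy (𝓕 (besselJ s f)) (fun ξ => (besselSymbol d s ξ : ℂ) * h ξ) := by
    intro φ
    have := hf.apply_mulF (besselSymbol_hasTemperateGrowth s) (𝓕 φ)
    rw [fourierInv_fourier_eq] at this
    exact this
  have h2 : RepresentedBy (𝓕 (besselJ s f)) (𝓕 u : Lp ℂ 2 (volume : Measure (Rd d))) := by
    have := representedBy_smul_Lp (g := fun _ : Rd d => (1 : ℂ)) (by fun_prop)
      (𝓕 u : Lp ℂ 2 (volume : Measure (Rd d)))
    rw [TemperedDistribution.smulLeftCLM_const, one_smul] at this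
    rw [hu, Lp.fourier_toTemperedDistribution_eq]
    simpa using this
  -- So `h` is ⟨ξ⟩^{-s} times an L² function and Cauchy–Schwarz applies. Only the size of `σ`
  -- enters, which admits symbols that are not smooth, such as |ξ|^β.
  have h3 := h1.ae_eq h2
  obtain ⟨v, hv⟩ : ∃ v : Lp ℂ 2 (volume : Measure (Rd d)), v = 𝓕 u := ⟨_, rfl⟩
  have hnv : ‖v‖ = ‖u‖ := by
    rw [hv]
    exact (Lp.fourierTransformₗᵢ (Rd d) ℂ).norm_map u
  rw [← hv] at h3
  set ψ := 𝓕⁻ (sJ (r - s) φ) with hψ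
  have hψx : ∀ ξ, ‖ψ ξ‖ = besselSymbol d (r - s) ξ * ‖𝓕⁻ φ ξ‖ := by
    intro ξ
    rw [hψ, sJ, fourierInv_mulF, norm_smulS_besselSymbol]
  have key : ‖∫ ξ, 𝓕⁻ φ ξ * (σ ξ * h ξ)‖ₑ ≤ ENNReal.ofReal (C * ‖u‖ * sNorm (sJ (r - s) φ)) := by
    calc ‖∫ ξ, 𝓕⁻ φ ξ * (σ ξ * h ξ)‖ₑ ≤ ∫⁻ ξ, ‖𝓕⁻ φ ξ * (σ ξ * h ξ)‖ₑ :=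
          enorm_integral_le_lintegral_enorm _
      _ ≤ ∫⁻ ξ, ENNReal.ofReal C * ‖ψ ξ • v ξ‖ₑ := by
          refine lintegral_mono_ae ?_
          filter_upwards [h3] with ξ hξ
          rw [← hξ, ← ofReal_norm, ← ofReal_norm, ← ENNReal.ofReal_mul hC0]
          refine ENNReal.ofReal_le_ofReal ?_
          rw [norm_smul, hψx, norm_mul, norm_mul, norm_mul, norm_ofReal_besselSymbol]
          calc ‖𝓕⁻ φ ξ‖ * (‖σ ξ‖ * ‖h ξ‖)
              ≤ ‖𝓕⁻ φ ξ‖ * (C * besselSymbol d r ξ * ‖h ξ‖) := by gcongr; exact hσ ξ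
            _ = ‖𝓕⁻ φ ξ‖ * (C * (besselSymbol d (r - s) ξ * besselSymbol d s ξ) * ‖h ξ‖) := by
                rw [besselSymbol_mul, sub_add_cancel]
            _ = _ := by ring
      _ = ENNReal.ofReal C * eLpNorm ((ψ : Rd d → ℂ) • (v : Rd d → ℂ)) 1 volume := by
          rw [lintegral_const_mul' _ _ ENNReal.ofReal_ne_top, eLpNorm_one_eq_lintegral_enorm]
          rfl
      _ ≤ ENNReal.ofReal C * (eLpNorm ψ 2 volume * eLpNorm v 2 volume) := by
          gcongr
          exact eLpNorm_smul_le_mul_eLpNorm (Lp.aestronglyMeasurable v)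
            ψ.continuous.aestronglyMeasurable
      _ = _ := by
          have : eLpNorm v 2 volume = ENNReal.ofReal ‖v‖ := by
            rw [Lp.norm_def, ENNReal.ofReal_toReal (Lp.eLpNorm_ne_top v)]
          rw [← ofReal_sNorm, this, hnv, hψ, sNorm_fourierInv, mul_assoc C,
            ENNReal.ofReal_mul hC0, ENNReal.ofReal_mul (norm_nonneg _), mul_comm (ENNReal.ofReal ‖u‖)]
  rw [← ofReal_norm] at key
  exact (ENNReal.ofReal_le_ofReal_iff (by have := sNorm_nonneg (sJ (r - s) φ); positivity)).1 key

theorem norm_apply_le_of_besselJ {f : TD d} {s W : ℝ}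
    (h : ∀ φ, ‖besselJ s f φ‖ ≤ W * sNorm φ) (φ : 𝓢(Rd d, ℂ)) :
    ‖f φ‖ ≤ W * sNorm (sJ (-s) φ) := by
  have := h (sJ (-s) φ)
  rwa [besselJ_apply, ← sJ, sJ_sJ, add_neg_cancel, sJ_zero] at this

/-! ### The high frequency parts of the symbols -/

/-- A smooth cutoff, equal to `1` on `[-1/2, 1/2]` and supported in `[-3/4, 3/4]`. -/
def unitBump : ContDiffBump (0 : ℝ) := ⟨1 / 2, 3 / 4, by norm_num, by norm_num⟩

theorem unitBump_eq_zero {u : ℝ} (hu : 3 / 4 ≤ u) : unitBump u = 0 :=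
  unitBump.zero_of_le_dist (by
    rw [Real.dist_eq, sub_zero]
    exact hu.trans (le_abs_self u))

/-- The power is singular only at u = 1, where the bump already vanishes. -/
theorem contDiff_unitBump_mul_rpow (γ : ℝ) :
    ContDiff ℝ ∞ (fun u : ℝ => unitBump u * (1 - u) ^ γ) := by
  rw [contDiff_iff_contDiffAt]
  intro u
  rcases lt_or_ge u 1 with hu | hu
  · exact unitBump.contDiffAt.mul
      ((contDiffAt_const.sub contDiffAt_id).rpow_const_of_ne (by simp; linarith))
  · refine contDiffAt_const (c := (0 : ℝ)).congr_of_eventuallyEq ?_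
    filter_upwards [lt_mem_nhds (show 3 / 4 < u by linarith)] with v hv
    rw [unitBump_eq_zero hv.le, zero_mul]

/-- The symbol `|ξ|^γ ⟨ξ⟩^{-γ}` cut off near the origin. -/
def highSymbol (d : ℕ) (γ : ℝ) (ξ : Rd d) : ℝ :=
  unitBump (besselSymbol d (-2) ξ) * (1 - besselSymbol d (-2) ξ) ^ (γ / 2)

/-- A smooth cutoff near the origin. -/
def lowSymbol (d : ℕ) (ξ : Rd d) : ℝ := 1 - unitBump (besselSymbol d (-2) ξ)

/-- ⟨ξ⟩^{-2} takes values in the compact interval [0, 1], on which all derivatives of `f` are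
bounded. -/
theorem isSymbol_comp_besselSymbol {f : ℝ → ℝ} (hf : ContDiff ℝ ∞ f) :
    IsSymbol 0 (fun ξ : Rd d => f (besselSymbol d (-2) ξ)) := by
  refine ((isSymbol_besselSymbol (-2)).mono (by norm_num)).comp hf fun i => ?_
  obtain ⟨C, hC⟩ := (isCompact_Icc (a := (0 : ℝ)) (b := 1)).exists_bound_of_continuousOn
    (hf.continuous_iteratedFDeriv (m := i) (mod_cast le_top)).continuousOn
  exact ⟨C, fun ξ => hC _ ⟨(besselSymbol_pos _ ξ).le, besselSymbol_le_one (by norm_num) ξ⟩⟩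

theorem isSymbol_highSymbol (γ : ℝ) : IsSymbol 0 (fun ξ : Rd d => (highSymbol d γ ξ : ℂ)) :=
  (isSymbol_comp_besselSymbol (contDiff_unitBump_mul_rpow (γ / 2))).ofReal

theorem isSymbol_lowSymbol : IsSymbol 0 (fun ξ : Rd d => (lowSymbol d ξ : ℂ)) :=
  (isSymbol_comp_besselSymbol (contDiff_const.sub unitBump.contDiff)).ofReal

/-- Since 1 - ⟨ξ⟩^{-2} = |2πξ|²⟨ξ⟩^{-2}, the quotient of |2πξ|^β by ⟨ξ⟩^β is a function of ⟨ξ⟩^{-2}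
alone. -/
theorem one_sub_besselSymbol_rpow {β : ℝ} (ξ : Rd d) :
    (1 - besselSymbol d (-2) ξ) ^ (β / 2) * besselSymbol d β ξ = (2 * π * ‖ξ‖) ^ β := by
  have h0 : 0 ≤ 2 * π * ‖ξ‖ := by positivity
  have h1 : 1 - besselSymbol d (-2) ξ = (2 * π * ‖ξ‖) ^ 2 / (1 + (2 * π * ‖ξ‖) ^ 2) := by
    rw [besselSymbol, neg_div, Real.rpow_neg (by positivity)]
    norm_num
    field_simp
    ring
  rw [h1, besselSymbol, ← Real.mul_rpow (by positivity) (by positivity), div_mul_cancel₀ _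
    (by positivity), ← Real.rpow_natCast, ← Real.rpow_mul h0]
  congr 1
  push_cast
  ring

theorem highSymbol_mul_besselSymbol_add (β : ℝ) (ξ : Rd d) :
    highSymbol d β ξ * besselSymbol d β ξ + lowSymbol d ξ * (2 * π * ‖ξ‖) ^ β =
      (2 * π * ‖ξ‖) ^ β := by
  rw [highSymbol, mul_assoc, one_sub_besselSymbol_rpow, lowSymbol]
  ring

theorem highSymbol_neg_mul_add (β : ℝ) (ξ : Rd d) :
    highSymbol d (-β) ξ * (2 * π * ‖ξ‖) ^ β + lowSymbol d ξ * besselSymbol d β ξ =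
      besselSymbol d β ξ := by
  rw [highSymbol, lowSymbol, ← one_sub_besselSymbol_rpow]
  rcases lt_or_ge (besselSymbol d (-2) ξ) (3 / 4) with h | h
  · have h1 : 0 < 1 - besselSymbol d (-2) ξ := by linarith
    have h2 : (1 - besselSymbol d (-2) ξ) ^ (-β / 2) * (1 - besselSymbol d (-2) ξ) ^ (β / 2) = 1 := by
      rw [← Real.rpow_add h1, neg_div, neg_add_cancel, Real.rpow_zero]
    linear_combination (unitBump (besselSymbol d (-2) ξ) * besselSymbol d β ξ) * h2
  · rw [unitBump_eq_zero h]
    ring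

/-- The cutoff vanishes where ⟨ξ⟩² ≥ 2; elsewhere ⟨ξ⟩^{s-r} is at most 2^{|s-r|/2}. -/
theorem exists_lowSymbol_mul_le (s r : ℝ) :
    ∃ C : ℝ, ∀ ξ : Rd d, ‖lowSymbol d ξ * besselSymbol d s ξ‖ ≤ C * besselSymbol d r ξ := by
  refine ⟨2 ^ (|s - r| / 2), fun ξ => ?_⟩
  have hs := besselSymbol_pos s ξ
  have hl0 : 0 ≤ lowSymbol d ξ := sub_nonneg.2 unitBump.le_one
  have hl1 : lowSymbol d ξ ≤ 1 := sub_le_self _ unitBump.nonneg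
  have hr := (besselSymbol_pos r ξ).le
  rw [Real.norm_of_nonneg (mul_nonneg hl0 hs.le)]
  rcases le_or_gt (besselSymbol d (-2) ξ) (1 / 2) with h | h
  · have : lowSymbol d ξ = 0 := by
      rw [lowSymbol, unitBump.one_of_mem_closedBall, sub_self]
      rw [Metric.mem_closedBall, Real.dist_eq, sub_zero, abs_of_pos (besselSymbol_pos _ ξ)]
      exact h
    rw [this, zero_mul]
    positivity
  · have h2 : besselSymbol d 2 ξ ≤ 2 := by
      have h3 : besselSymbol d (-2) ξ * besselSymbol d 2 ξ = 1 := by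
        rw [besselSymbol_mul, neg_add_cancel, besselSymbol_zero]
      nlinarith [besselSymbol_pos 2 ξ]
    refine (mul_le_of_le_one_left hs.le hl1).trans ?_
    have h4 : besselSymbol d (s - r) ξ ≤ 2 ^ (|s - r| / 2) := by
      refine (besselSymbol_mono (le_abs_self _) ξ).trans ?_
      rw [besselSymbol, ← besselSymbol_two]
      exact Real.rpow_le_rpow (besselSymbol_pos 2 ξ).le h2 (by positivity)
    calc besselSymbol d s ξ = besselSymbol d (s - r) ξ * besselSymbol d r ξ := by
          rw [besselSymbol_mul, sub_add_cancel]
      _ ≤ _ := mul_le_mul_of_nonneg_right h4 hr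

theorem norm_rpow_le_besselSymbol {β : ℝ} (hβ : 0 ≤ β) (ξ : Rd d) :
    (2 * π * ‖ξ‖) ^ β ≤ besselSymbol d β ξ := by
  rw [← one_sub_besselSymbol_rpow]
  refine mul_le_of_le_one_left (besselSymbol_pos β ξ).le (Real.rpow_le_one ?_ ?_ (by positivity))
  · exact sub_nonneg.2 (besselSymbol_le_one (by norm_num) ξ)
  · exact sub_le_self _ (besselSymbol_pos _ ξ).le

/-! ### Sobolev bounds tested on Schwartz functions -/

theorem besselJ_apply_eq_sJ (s : ℝ) (f : TD d) (φ : 𝓢(Rd d, ℂ)) : besselJ s f φ = f (sJ s φ) := rfl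

theorem MemH.exists_bound {s : ℝ} {f : TD d} (hf : MemH s f) :
    ∃ u : Lp ℂ 2 (volume : Measure (Rd d)), besselJ s f = (u : TD d) ∧
      l2Norm (besselJ s f) = ENNReal.ofReal ‖u‖ ∧
      ∀ φ, ‖f φ‖ ≤ ‖u‖ * sNorm (sJ (-s) φ) := by
  obtain ⟨u, hu⟩ := hf
  refine ⟨u, hu, by rw [hu, l2Norm_coe, ofReal_norm], norm_apply_le_of_besselJ fun φ => ?_⟩
  rw [hu]
  exact norm_Lp_apply_le u φ

theorem norm_besselJ_apply_le {s r W : ℝ} {f : TD d} (h : ∀ φ, ‖f φ‖ ≤ W * sNorm (sJ s φ))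
    (φ : 𝓢(Rd d, ℂ)) : ‖besselJ r f φ‖ ≤ W * sNorm (sJ (s + r) φ) := by
  rw [besselJ_apply_eq_sJ, ← sJ_sJ]
  exact h _

/-! ### The localized estimates -/

section Localization

variable {θ₁ θ₂ : Rd d → ℝ} {δ : ℝ}

/-- J^β is a multiplier of order 0 applied to D^β, plus a low frequency remainder that the norm of
order `s` controls. The localized bound is used for g = D^β f, which globally has order s - β. -/
theorem exists_bound_mulDist_besselJ_of_fracD (h₁ : BddSmooth θ₁) (h₂ : BddSmooth θ₂)
    (hδ : 0 < δ) (hsep : ∀ x, θ₁ x ≠ 1 → ∀ y, θ₂ y ≠ 0 → δ ≤ dist x y) (s : ℝ) {β : ℝ}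
    (hβ : 0 ≤ β) : ∃ C : ℝ≥0, ∀ f : TD d, MemH s f → MemL2 (mulDist θ₁ (fracD β f)) →
      MemL2 (mulDist θ₂ (besselJ β f)) ∧ l2Norm (mulDist θ₂ (besselJ β f)) ≤
        C * (l2Norm (mulDist θ₁ (fracD β f)) + l2Norm (besselJ s f)) := by
  have ha := isSymbol_highSymbol (d := d) (-β)
  have hc : (fun ξ : Rd d => ((lowSymbol d ξ * besselSymbol d β ξ : ℝ) : ℂ)).HasTemperateGrowth := by
    have h1 := (isSymbol_lowSymbol (d := d)).hasTemperateGrowth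
    have h2 := besselSymbol_hasTemperateGrowth (d := d) β
    simp_rw [Complex.ofReal_mul]
    fun_prop
  obtain ⟨C, hC0, hC⟩ := exists_localized_bound h₁ h₂ hδ hsep ha (β - s)
  obtain ⟨D, hD⟩ := exists_lowSymbol_mul_le (d := d) β s
  have hD0 : 0 ≤ D := nonneg_of_norm_le_mul_besselSymbol (hD 0)
  obtain ⟨B, hB0, hB⟩ := SobolevBounded.zero h₂
  simp only [sJ_zero] at hB hC
  refine ⟨⟨C + D * B, by positivity⟩, fun f hf hg => ?_⟩
  obtain ⟨u, hu, hun, hfb⟩ := hf.exists_bound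
  obtain ⟨A, hA0, hAn, hgA⟩ := hg.exists_bound
  obtain ⟨h, hh, hgh⟩ := isFracDeriv_fracD hβ hf
  have hgW : ∀ ψ, ‖fracD β f ψ‖ ≤ ‖u‖ * sNorm (sJ (β - s) ψ) := by
    intro ψ
    rw [(hgh.apply_eq ψ).2]
    refine (norm_integral_symbol_le hu hh (C := 1) (r := β) (fun ξ => ?_) ψ).trans
      (by rw [one_mul])
    rw [one_mul, Complex.norm_real, Real.norm_of_nonneg (by positivity)]
    exact norm_rpow_le_besselSymbol hβ ξ
  have hlow : ∀ ψ, ‖f (mulF (fun ξ => ((lowSymbol d ξ * besselSymbol d β ξ : ℝ) : ℂ)) ψ)‖ ≤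
      D * ‖u‖ * sNorm ψ := by
    intro ψ
    rw [(hh.apply_mulF hc ψ).2]
    have := norm_integral_symbol_le hu hh (C := D) (r := s) (fun ξ => by
      rw [Complex.norm_real]; exact hD ξ) ψ
    rwa [sub_self, sJ_zero] at this
  -- |ξ|^β is in general not a multiplier of Schwartz functions, so the identity of symbols is used
  -- under the integral against 𝓕 f.
  have hsplit : ∀ ψ, f (sJ β ψ) = fracD β f (mulF (fun ξ => (highSymbol d (-β) ξ : ℂ)) ψ) +
      f (mulF (fun ξ => ((lowSymbol d ξ * besselSymbol d β ξ : ℝ) : ℂ)) ψ) := by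
    intro ψ
    have e1 := hgh.apply_mulF ha.hasTemperateGrowth ψ
    have e2 := hh.apply_mulF hc ψ
    rw [e1.2, e2.2, sJ, (hh.apply_mulF (besselSymbol_hasTemperateGrowth β) ψ).2,
      ← integral_add e1.1 e2.1]
    congr 1
    ext ξ
    have e := congrArg (fun r : ℝ => (r : ℂ)) (highSymbol_neg_mul_add β ξ)
    simp only [Complex.ofReal_add, Complex.ofReal_mul] at e ⊢
    linear_combination (-(𝓕⁻ ψ ξ) * h ξ) * e
  have main : ∀ φ, ‖mulDist θ₂ (besselJ β f) φ‖ ≤ (C + D * B) * (A + ‖u‖) * sNorm φ := by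
    intro φ
    rw [mulDist_apply, besselJ_apply_eq_sJ, hsplit]
    have hN := sNorm_nonneg φ
    have b1 := hC (fracD β f) A ‖u‖ hA0 (norm_nonneg u) hgA hgW φ
    have b2 : ‖f (mulF (fun ξ => ((lowSymbol d ξ * besselSymbol d β ξ : ℝ) : ℂ))
        (smulR θ₂ φ))‖ ≤ D * ‖u‖ * (B * sNorm φ) :=
      (hlow _).trans (mul_le_mul_of_nonneg_left (hB φ) (by positivity))
    refine (norm_add_le _ _).trans ((add_le_add b1 b2).trans ?_)
    have p : 0 ≤ D * A * (B * sNorm φ) := by positivity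
    nlinarith
  obtain ⟨r1, r2⟩ := memL2_of_bound (by positivity) main
  refine ⟨r1, r2.trans (le_of_eq ?_)⟩
  rw [hun, hAn, ENNReal.ofReal_mul (by positivity), ENNReal.ofReal_add hA0 (norm_nonneg u)]
  congr 1
  exact ENNReal.ofReal_eq_coe_nnreal _

/-- J^r = J^{r-s} J^s, and J^{r-s} has order at most 0. -/
theorem exists_bound_mulDist_besselJ (h₁ : BddSmooth θ₁) (h₂ : BddSmooth θ₂)
    (hδ : 0 < δ) (hsep : ∀ x, θ₁ x ≠ 1 → ∀ y, θ₂ y ≠ 0 → δ ≤ dist x y) (l : ℝ) {s r : ℝ}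
    (hrs : r ≤ s) : ∃ C : ℝ≥0, ∀ f : TD d, MemH l f → MemL2 (mulDist θ₁ (besselJ s f)) →
      MemL2 (mulDist θ₂ (besselJ r f)) ∧ l2Norm (mulDist θ₂ (besselJ r f)) ≤
        C * (l2Norm (mulDist θ₁ (besselJ s f)) + l2Norm (besselJ l f)) := by
  have ha : IsSymbol 0 fun ξ : Rd d => (besselSymbol d (r - s) ξ : ℂ) :=
    (isSymbol_besselSymbol (r - s)).ofReal.mono (by linarith)
  obtain ⟨C, hC0, hC⟩ := exists_localized_bound h₁ h₂ hδ hsep ha (-l + s)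
  simp only [sJ_zero] at hC
  refine ⟨⟨C, hC0⟩, fun f hf hg => ?_⟩
  obtain ⟨u, hu, hun, hfb⟩ := hf.exists_bound
  obtain ⟨A, hA0, hAn, hgA⟩ := hg.exists_bound
  have main : ∀ φ, ‖mulDist θ₂ (besselJ r f) φ‖ ≤ C * (A + ‖u‖) * sNorm φ := by
    intro φ
    have b := hC (besselJ s f) A ‖u‖ hA0 (norm_nonneg u) hgA (norm_besselJ_apply_le hfb) φ
    rw [besselJ_apply_eq_sJ, ← sJ, sJ_sJ, add_sub_cancel] at b
    exact b
  obtain ⟨r1, r2⟩ := memL2_of_bound (by positivity) main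
  refine ⟨r1, r2.trans (le_of_eq ?_)⟩
  rw [hun, hAn, ENNReal.ofReal_mul (by positivity), ENNReal.ofReal_add hA0 (norm_nonneg u)]
  congr 1
  exact ENNReal.ofReal_eq_coe_nnreal _

/-- Tested on φ, the distribution is J^s f tested on J^{-s}(θ₂ J^s φ). The localized bound for order
-s, applied to J^s φ, gives back the L² norm of φ. -/
theorem exists_bound_besselJ_mulDist (h₁ : BddSmooth θ₁) (h₂ : BddSmooth θ₂)
    (hδ : 0 < δ) (hsep : ∀ x, θ₁ x ≠ 1 → ∀ y, θ₂ y ≠ 0 → δ ≤ dist x y) (l s : ℝ) :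
    ∃ C : ℝ≥0, ∀ f : TD d, MemH l f → MemL2 (mulDist θ₁ (besselJ s f)) →
      MemL2 (besselJ s (mulDist θ₂ f)) ∧ l2Norm (besselJ s (mulDist θ₂ f)) ≤
        C * (l2Norm (mulDist θ₁ (besselJ s f)) + l2Norm (besselJ l f)) := by
  have ha : IsSymbol (-s) fun ξ : Rd d => (besselSymbol d (-s) ξ : ℂ) :=
    (isSymbol_besselSymbol (-s)).ofReal
  obtain ⟨C, hC0, hC⟩ := exists_localized_bound h₁ h₂ hδ hsep ha (-l + s)
  refine ⟨⟨C, hC0⟩, fun f hf hg => ?_⟩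
  obtain ⟨u, hu, hun, hfb⟩ := hf.exists_bound
  obtain ⟨A, hA0, hAn, hgA⟩ := hg.exists_bound
  have main : ∀ φ, ‖besselJ s (mulDist θ₂ f) φ‖ ≤ C * (A + ‖u‖) * sNorm φ := by
    intro φ
    have b := hC (besselJ s f) A ‖u‖ hA0 (norm_nonneg u) hgA (norm_besselJ_apply_le hfb) (sJ s φ)
    rw [besselJ_apply_eq_sJ, ← sJ, sJ_sJ, sJ_sJ, add_neg_cancel, neg_add_cancel, sJ_zero,
      sJ_zero] at b
    exact b
  obtain ⟨r1, r2⟩ := memL2_of_bound (by positivity) main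
  refine ⟨r1, r2.trans (le_of_eq ?_)⟩
  rw [hun, hAn, ENNReal.ofReal_mul (by positivity), ENNReal.ofReal_add hA0 (norm_nonneg u)]
  congr 1
  exact ENNReal.ofReal_eq_coe_nnreal _

/-- The mirror image: D^β is a multiplier of order 0 applied to J^β, plus a low frequency remainder.
-/
theorem exists_bound_mulDist_fracD (h₁ : BddSmooth θ₁) (h₂ : BddSmooth θ₂)
    (hδ : 0 < δ) (hsep : ∀ x, θ₁ x ≠ 1 → ∀ y, θ₂ y ≠ 0 → δ ≤ dist x y) (s : ℝ) {β : ℝ}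
    (hβ : 0 ≤ β) : ∃ C : ℝ≥0, ∀ f : TD d, MemH s f → MemL2 (mulDist θ₁ (besselJ β f)) →
      MemL2 (mulDist θ₂ (fracD β f)) ∧ l2Norm (mulDist θ₂ (fracD β f)) ≤
        C * (l2Norm (mulDist θ₁ (besselJ β f)) + l2Norm (besselJ s f)) := by
  have ha := isSymbol_highSymbol (d := d) β
  obtain ⟨C, hC0, hC⟩ := exists_localized_bound h₁ h₂ hδ hsep ha (-s + β)
  obtain ⟨D, hD⟩ := exists_lowSymbol_mul_le (d := d) β s
  have hD0 : 0 ≤ D := nonneg_of_norm_le_mul_besselSymbol (hD 0)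
  obtain ⟨B, hB0, hB⟩ := SobolevBounded.zero h₂
  simp only [sJ_zero] at hB hC
  refine ⟨⟨C + D * B, by positivity⟩, fun f hf hg => ?_⟩
  obtain ⟨u, hu, hun, hfb⟩ := hf.exists_bound
  obtain ⟨A, hA0, hAn, hgA⟩ := hg.exists_bound
  obtain ⟨h, hh, hgh⟩ := isFracDeriv_fracD hβ hf
  have hlow : ∀ ψ, ‖fracD β f ψ - besselJ β f (mulF (fun ξ => (highSymbol d β ξ : ℂ)) ψ)‖ ≤
      D * ‖u‖ * sNorm ψ := by
    intro ψ
    have hg' : (fun ξ : Rd d => ((besselSymbol d β ξ : ℝ) : ℂ) *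
        (highSymbol d β ξ : ℂ)).HasTemperateGrowth := by
      have h1 := ha.hasTemperateGrowth
      have h2 := besselSymbol_hasTemperateGrowth (d := d) β
      fun_prop
    have e1 := hgh.apply_eq ψ
    have e2 := hh.apply_mulF hg' ψ
    have e3 : fracD β f ψ - besselJ β f (mulF (fun ξ => (highSymbol d β ξ : ℂ)) ψ) =
        ∫ ξ, 𝓕⁻ ψ ξ * (((lowSymbol d ξ * (2 * π * ‖ξ‖) ^ β : ℝ) : ℂ) * h ξ) := by
      rw [besselJ_apply, mulF_mulF (besselSymbol_hasTemperateGrowth β) ha.hasTemperateGrowth,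
        e1.2, e2.2, ← integral_sub e1.1 e2.1]
      congr 1
      ext ξ
      nth_rw 1 [← highSymbol_mul_besselSymbol_add β ξ]
      push_cast
      ring
    rw [e3]
    have := norm_integral_symbol_le hu hh (C := D) (r := s)
      (σ := fun ξ => ((lowSymbol d ξ * (2 * π * ‖ξ‖) ^ β : ℝ) : ℂ)) (fun ξ => by
      refine le_trans ?_ (hD ξ)
      rw [Complex.norm_real, norm_mul, norm_mul, Real.norm_of_nonneg (show (0:ℝ) ≤ (2 * π * ‖ξ‖) ^ β by positivity),
        Real.norm_of_nonneg (besselSymbol_pos β ξ).le]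
      exact mul_le_mul_of_nonneg_left (norm_rpow_le_besselSymbol hβ ξ) (norm_nonneg _)) ψ
    rwa [sub_self, sJ_zero] at this
  have main : ∀ φ, ‖mulDist θ₂ (fracD β f) φ‖ ≤ (C + D * B) * (A + ‖u‖) * sNorm φ := by
    intro φ
    rw [mulDist_apply, ← sub_add_cancel (fracD β f (smulS (fun x => (θ₂ x : ℂ)) φ))
      (besselJ β f (mulF (fun ξ => (highSymbol d β ξ : ℂ)) (smulR θ₂ φ)))]
    have hN := sNorm_nonneg φ
    have b1 := hC (besselJ β f) A ‖u‖ hA0 (norm_nonneg u) hgA (norm_besselJ_apply_le hfb) φ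
    have b2 := (hlow (smulR θ₂ φ)).trans (mul_le_mul_of_nonneg_left (hB φ)
      (show 0 ≤ D * ‖u‖ by positivity))
    refine (norm_add_le _ _).trans ((add_le_add b2 b1).trans ?_)
    have p : 0 ≤ D * A * (B * sNorm φ) := by positivity
    nlinarith
  obtain ⟨r1, r2⟩ := memL2_of_bound (by positivity) main
  refine ⟨r1, r2.trans (le_of_eq ?_)⟩
  rw [hun, hAn, ENNReal.ofReal_mul (by positivity), ENNReal.ofReal_add hA0 (norm_nonneg u)]
  congr 1
  exact ENNReal.ofReal_eq_coe_nnreal _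

end Localization

theorem besselJ_zero (f : TD d) : besselJ 0 f = f := by
  ext φ
  rw [besselJ_apply_eq_sJ, sJ_zero]

end FracLoc

end

theorem lemma3p12 (d : ℕ) (hd : 1 ≤ d) (m : ℕ)
    (θ₁ θ₂ : FracLoc.Rd d → ℝ) (hθ₁ : FracLoc.IsCutoff θ₁) (hθ₂ : FracLoc.IsCutoff θ₂)
    (δ : ℝ) (hδ : 0 < δ)
    (hsep : ∀ x ∈ tsupport (fun z => 1 - θ₁ z), ∀ y ∈ tsupport θ₂, δ ≤ dist x y) :
    -- (I)
    (∀ β : ℝ, 0 ≤ β → β < 2 → ∃ C : ℝ≥0, ∀ f : FracLoc.TD d, FracLoc.MemH (-(m : ℝ)) f →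
      FracLoc.MemL2 (FracLoc.mulDist θ₁ f) →
      FracLoc.MemL2 (FracLoc.mulDist θ₁ (FracLoc.fracD β f)) →
      FracLoc.MemL2 (FracLoc.mulDist θ₂ (FracLoc.besselJ β f)) ∧
      FracLoc.l2Norm (FracLoc.mulDist θ₂ (FracLoc.besselJ β f)) ≤
        C * (FracLoc.l2Norm (FracLoc.mulDist θ₁ f) +
          FracLoc.l2Norm (FracLoc.mulDist θ₁ (FracLoc.fracD β f)) +
          FracLoc.l2Norm (FracLoc.besselJ (-(m : ℝ)) f))) ∧
    -- (II)
    (∀ β : ℝ, 0 ≤ β → β < 2 → ∃ C : ℝ≥0, ∀ f : FracLoc.TD d, FracLoc.MemH (-(m : ℝ)) f →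
      FracLoc.MemL2 (FracLoc.mulDist θ₁ (FracLoc.besselJ β f)) →
      FracLoc.MemL2 (FracLoc.mulDist θ₂ f) ∧
      FracLoc.MemL2 (FracLoc.mulDist θ₂ (FracLoc.fracD β f)) ∧
      FracLoc.l2Norm (FracLoc.mulDist θ₂ f) +
          FracLoc.l2Norm (FracLoc.mulDist θ₂ (FracLoc.fracD β f)) ≤
        C * (FracLoc.l2Norm (FracLoc.mulDist θ₁ (FracLoc.besselJ β f)) +
          FracLoc.l2Norm (FracLoc.besselJ (-(m : ℝ)) f))) ∧
    -- (III)
    (∀ s r : ℝ, 0 < s → 0 ≤ r → r ≤ s → ∃ C : ℝ≥0, ∀ f : FracLoc.TD d,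
      FracLoc.MemH (-(m : ℝ)) f →
      FracLoc.MemL2 (FracLoc.mulDist θ₁ (FracLoc.besselJ s f)) →
      FracLoc.MemL2 (FracLoc.mulDist θ₂ (FracLoc.besselJ r f)) ∧
      FracLoc.l2Norm (FracLoc.mulDist θ₂ (FracLoc.besselJ r f)) ≤
        C * (FracLoc.l2Norm (FracLoc.mulDist θ₁ (FracLoc.besselJ s f)) +
          FracLoc.l2Norm (FracLoc.besselJ (-(m : ℝ)) f))) ∧
    -- (IV)
    (∀ s : ℝ, 0 < s → ∃ C : ℝ≥0, ∀ f : FracLoc.TD d, FracLoc.MemH (-(m : ℝ)) f →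
      FracLoc.MemL2 (FracLoc.mulDist θ₁ (FracLoc.besselJ s f)) →
      FracLoc.MemL2 (FracLoc.besselJ s (FracLoc.mulDist θ₂ f)) ∧
      FracLoc.l2Norm (FracLoc.besselJ s (FracLoc.mulDist θ₂ f)) ≤
        C * (FracLoc.l2Norm (FracLoc.mulDist θ₁ (FracLoc.besselJ s f)) +
          FracLoc.l2Norm (FracLoc.besselJ (-(m : ℝ)) f))) := by
  have h₁ := hθ₁.bddSmooth
  have h₂ := hθ₂.bddSmooth
  have hs : ∀ x, θ₁ x ≠ 1 → ∀ y, θ₂ y ≠ 0 → δ ≤ dist x y := fun x hx y hy =>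
    hsep x (subset_tsupport _ (sub_ne_zero.2 hx.symm)) y (subset_tsupport _ hy)
  refine ⟨fun β hβ _ => ?_, fun β hβ _ => ?_, fun s r _ _ hrs => ?_, fun s _ => ?_⟩
  · obtain ⟨C, hC⟩ := FracLoc.exists_bound_mulDist_besselJ_of_fracD h₁ h₂ hδ hs (-(m : ℝ)) hβ
    refine ⟨C, fun f hf _ hg => ⟨(hC f hf hg).1, (hC f hf hg).2.trans ?_⟩⟩
    gcongr
    exact le_add_self
  -- The bound on θ₂ f is the case r = 0, s = β of the comparison of Bessel orders.
  · obtain ⟨C, hC⟩ := FracLoc.exists_bound_mulDist_besselJ h₁ h₂ hδ hs (-(m : ℝ)) hβ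
    obtain ⟨D, hD⟩ := FracLoc.exists_bound_mulDist_fracD h₁ h₂ hδ hs (-(m : ℝ)) hβ
    refine ⟨C + D, fun f hf hg => ?_⟩
    obtain ⟨c1, c2⟩ := hC f hf hg
    obtain ⟨d1, d2⟩ := hD f hf hg
    rw [FracLoc.besselJ_zero] at c1 c2
    refine ⟨c1, d1, (add_le_add c2 d2).trans (le_of_eq ?_)⟩
    rw [ENNReal.coe_add, add_mul]
  · exact FracLoc.exists_bound_mulDist_besselJ h₁ h₂ hδ hs (-(m : ℝ)) hrs
  · exact FracLoc.exists_bound_besselJ_mulDist h₁ h₂ hδ hs (-(m : ℝ)) s
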